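/- Let $\mathbb{K}$ be a field of characteristic zero and $d\ge 1$. For a finite set $A$ let $\mathrm{Sym}^{(d)}_A$ be the $\mathbb{K}$-vector space with basis the monomials $z_{A_1}\cdots z_{A_n}$ in commuting variables, indexed by the unordered partitions $A=A_1\sqcup\cdots\sqcup A_n$ with all $|A_i|=d$ (so it is $0$ if $d\nmid |A|$). It is functorial for bijections of finite sets, and multiplication of monomials gives maps $\mathrm{Sym}^{(d)}_A\otimes\mathrm{Sym}^{(d)}_B\to\mathrm{Sym}^{(d)}_{A\sqcup B}$. An ideal of $\mathrm{Sym}^{(d)}$ is a family of subspaces $\mathscr{I}_A\subseteq\mathrm{Sym}^{(d)}_A$, stable under all bijections $A\to B$, with $\mathscr{I}_A\cdot\mathrm{Sym}^{(d)}_B\subseteq\mathscr{I}_{A\sqcup B}$ for all $A,B$; the ideal generated by a collection of elements is the smallest ideal containing it. Graphs are finite and without loops; multiple edges are allowed, so $E(Q)$ is a multiset. Let $Q$ be a graph with $n$ vertices and $e$ edges in which every vertex is incident to at most $d$ edges. Label the vertices by $[n]$ and let $F:D_\lambda\to[n]$ be a filling of the Young diagram of $\lambda=(nd-e,e)$ in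 which each element of $[n]$ occurs exactly $d$ times and whose columns of size two are, up to the order of their entries, the edges of $Q$. The graph covariant $[Q]$ is the collection of all elements $t_F(A,T)=\mathfrak{c}_\lambda(T)\cdot\prod_{i=1}^n z_{T(F^{-1}(i))}\in\mathrm{Sym}^{(d)}_A$, where $T:D_\lambda\to A$ is a bijection and $\mathfrak{c}_\lambda(T)=\big(\sum_{\sigma}\sigma\big)\big(\sum_{\tau}\mathrm{sgn}(\tau)\,\tau\big)$ is the Young symmetrizer, with $\sigma$ (resp. $\tau$) running over the permutations of $A$ that preserve each row (resp. column) of $T$. Let $\mathscr{I}(Q)$ be the ideal generated by $[Q]$, and for a set $\mathcal{Q}$ of graphs let $\mathscr{I}(\mathcal{Q})$ be the ideal generated by the $[\tilde Q]$, $\tilde Q\in\mathcal{Q}$. **Proposition.** Let $Q$ be a graph in which every vertex is incident to at most $d$ edges, and let $Q'$ be a subgraph of $Q$. Let $\mathcal{Q}$ be the set of graphs $\tilde Q$, with at most $d$ edges incident to each vertex, such that $V(\tilde Q)=V(Q')$, $E(Q')\subseteq E(\tilde Q)$ (as multisets) and $|E(\tilde Q)|\le|E(Q)|$. Then $$\mathscr{I}(Q)\subseteq\mathscr{I}(\mathcal{Q}),$$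 whatever choices of labellings and fillings $F$ are made in the construction of the covariants of $Q$ and of the $\tilde Q$. -/

import Mathlib

open Finset

universe u v w

/-! ### The functor `Sym^(d)` -/

/-- Partitions `A = A₁ ⊔ ⋯ ⊔ Aₙ` of `A` (unordered) into blocks with exactly `d` elements,
presented as equivalence relations. -/
def DPartition (d : ℕ) (A : Type u) : Type u :=
  {r : Setoid A // ∀ c ∈ r.classes, c.ncard = d}

namespace DPartition

/-- An equivalence relation all of whose classes `{b | b ~ a}` have `d` elements. -/
def mk' {d : ℕ} {A : Type u} (r : Setoid A) (h : ∀ a, {b | r b a}.ncard = d) :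
    DPartition d A :=
  ⟨r, by rintro c ⟨a, rfl⟩; exact h a⟩

theorem ncard_class {d : ℕ} {A : Type u} (P : DPartition d A) (a : A) :
    {b | P.1 b a}.ncard = d :=
  P.2 _ ⟨a, rfl⟩

/-- Transport of a partition along a bijection `A ≃ B`: the blocks of the result are the images
of the blocks. -/
def map {d : ℕ} {A B : Type u} (φ : A ≃ B) (P : DPartition d A) : DPartition d B :=
  mk' (Setoid.comap φ.symm P.1) (fun b => by
    have h : {x | (Setoid.comap φ.symm P.1) x b} = φ '' {y | P.1 y (φ.symm b)} := by
      ext x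
      simp [Setoid.comap_rel, Equiv.image_eq_preimage_symm]
    rw [h, Set.ncard_image_of_injective _ φ.injective, ncard_class])

/-- The equivalence relation on `A ⊕ B` whose blocks are the blocks of `r` and those of `s`. -/
def sumSetoid {A B : Type u} (r : Setoid A) (s : Setoid B) : Setoid (A ⊕ B) where
  r := Sum.LiftRel r s
  iseqv :=
    { refl := by rintro (a | b) <;> simp [Sum.liftRel_inl_inl, Sum.liftRel_inr_inr, Setoid.refl]
      symm := by
        rintro _ _ (h | h)
        · exact .inl (r.symm' h)
        · exact .inr (s.symm' h)
      trans := by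
        rintro _ _ _ (h | h) (h' | h')
        · exact .inl (r.trans' h h')
        · exact .inr (s.trans' h h') }

/-- The partition of `A ⊔ B` formed by the blocks of a partition of `A` and the blocks of a
partition of `B`. -/
def disjUnion {d : ℕ} {A B : Type u} (P : DPartition d A) (R : DPartition d B) :
    DPartition d (A ⊕ B) :=
  mk' (sumSetoid P.1 R.1) (by
    rintro (a | b)
    · have h : {x | (sumSetoid P.1 R.1) x (Sum.inl a)} = Sum.inl '' {y | P.1 y a} := by
        ext (x | x)
        · exact Sum.liftRel_inl_inl.trans (by simp)
        · exact iff_of_false Sum.not_liftRel_inr_inl (by simp)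
      rw [h, Set.ncard_image_of_injective _ Sum.inl_injective, ncard_class]
    · have h : {x | (sumSetoid P.1 R.1) x (Sum.inr b)} = Sum.inr '' {y | R.1 y b} := by
        ext (x | x)
        · exact iff_of_false Sum.not_liftRel_inl_inr (by simp)
        · exact Sum.liftRel_inr_inr.trans (by simp)
      rw [h, Set.ncard_image_of_injective _ Sum.inr_injective, ncard_class])

theorem map_refl {d : ℕ} {A : Type u} (P : DPartition d A) : P.map (Equiv.refl A) = P := rfl

theorem map_trans {d : ℕ} {A B C : Type u} (φ : A ≃ B) (ψ : B ≃ C) (P : DPartition d A) :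
    P.map (φ.trans ψ) = (P.map φ).map ψ := rfl

end DPartition

/-- The vector space `Sym^(d)_A`, with basis the monomials `z_{A₁} ⋯ z_{Aₙ}` indexed by the
partitions of `A` into blocks of size `d`. It is the zero space if `d` does not divide `|A|`. -/
abbrev GenSym (K : Type w) [Field K] (d : ℕ) (A : Type u) : Type (max u w) :=
  DPartition d A →₀ K

namespace GenSym

/-- Functoriality of `Sym^(d)` for bijections `A ≃ B`. -/
noncomputable def map (K : Type w) [Field K] (d : ℕ) {A B : Type u} (φ : A ≃ B) :
    GenSym K d A →ₗ[K] GenSym K d B :=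
  Finsupp.lmapDomain K K (DPartition.map φ)

/-- The multiplication `Sym^(d)_A ⊗ Sym^(d)_B → Sym^(d)_{A ⊔ B}`: on basis elements it is the
product of monomials. -/
noncomputable def mul (K : Type w) [Field K] (d : ℕ) {A B : Type u} :
    GenSym K d A →ₗ[K] GenSym K d B →ₗ[K] GenSym K d (A ⊕ B) :=
  Finsupp.linearCombination K
    (fun P : DPartition d A => Finsupp.lmapDomain K K (DPartition.disjUnion (B := B) P))

/-- `Sym^(d)_A` as a representation of the symmetric group of `A`. -/
noncomputable def rep (K : Type w) [Field K] (d : ℕ) (A : Type u) :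
    Representation K (Equiv.Perm A) (GenSym K d A) where
  toFun σ := map K d σ
  map_one' := Finsupp.lmapDomain_id K K
  map_mul' σ τ := Finsupp.lmapDomain_comp K K (DPartition.map τ) (DPartition.map σ)

end GenSym

/-- An ideal of `Sym^(d)`: a subfunctor `I` (a family of subspaces `I_A ⊆ Sym^(d)_A`, for finite
sets `A`, stable under all bijections) with `I_A · Sym^(d)_B ⊆ I_{A ⊔ B}`. -/
structure GenIdeal (K : Type w) [Field K] (d : ℕ) where
  carrier : ∀ (A : Type u) [Finite A], Submodule K (GenSym K d A)
  map_mem : ∀ (A B : Type u) [Finite A] [Finite B] (φ : A ≃ B) (x : GenSym K d A),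
    x ∈ carrier A → GenSym.map K d φ x ∈ carrier B
  mul_mem : ∀ (A B : Type u) [Finite A] [Finite B] (x : GenSym K d A) (y : GenSym K d B),
    x ∈ carrier A → GenSym.mul K d x y ∈ carrier (A ⊕ B)

/-- Sets of elements of `Sym^(d)`, sorted by the finite set `A` they live over. -/
def GenElements (K : Type w) [Field K] (d : ℕ) : Type (max (u + 1) w) :=
  ∀ (A : Type u) [Finite A], Set (GenSym K d A)

namespace GenIdeal

/-- Containment of ideals. -/
instance (K : Type w) [Field K] (d : ℕ) : LE (GenIdeal.{u} K d) :=
  ⟨fun I J => ∀ (A : Type u) [Finite A], I.carrier A ≤ J.carrier A⟩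

/-- The ideal contains a given set of elements. -/
def Contains {K : Type w} [Field K] {d : ℕ} (I : GenIdeal.{u} K d)
    (E : GenElements.{u} K d) : Prop :=
  ∀ (A : Type u) [Finite A], ∀ x ∈ E A, x ∈ I.carrier A

/-- The ideal generated by a set of elements: the intersection of all ideals that contain it. -/
noncomputable def generatedBy {K : Type w} [Field K] {d : ℕ} (E : GenElements.{u} K d) :
    GenIdeal.{u} K d where
  carrier A _ := ⨅ (J : GenIdeal.{u} K d) (_ : J.Contains E), J.carrier A
  map_mem A B _ _ φ x hx := by
    simp only [Submodule.mem_iInf] at hx ⊢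
    exact fun J hJ => J.map_mem A B φ x (hx J hJ)
  mul_mem A B _ _ x y hx := by
    simp only [Submodule.mem_iInf] at hx ⊢
    exact fun J hJ => J.mul_mem A B x y (hx J hJ)

end GenIdeal

/-! ### Young symmetrizers and tabloids -/

/-- A Young tableau of shape `μ` with set of entries `A`: a bijection from the boxes of the Young
diagram (a box `(i, j)` lies in row `i` and column `j`, counted from `0`) to `A`. -/
abbrev Tableau (μ : YoungDiagram) (A : Type u) : Type u := {c // c ∈ μ.cells} ≃ A

namespace Tableau

/-- The row of the tableau that contains `a`. -/
def row {μ : YoungDiagram} {A : Type u} (T : Tableau μ A) (a : A) : ℕ := (T.symm a).1.1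

/-- The column of the tableau that contains `a`. -/
def col {μ : YoungDiagram} {A : Type u} (T : Tableau μ A) (a : A) : ℕ := (T.symm a).1.2

/-- The Young symmetrizer `c(T) = a(T) · b(T)` in the group algebra of the symmetric group of `A`,
where `a(T)` is the sum of the permutations preserving the rows of `T`, and `b(T)` is the signed
sum of those preserving the columns. -/
noncomputable def symmetrizer (K : Type w) [Field K] {μ : YoungDiagram} {A : Type u} [Fintype A]
    [DecidableEq A] (T : Tableau μ A) : MonoidAlgebra K (Equiv.Perm A) :=
  (∑ σ : Equiv.Perm A with ∀ a, T.row (σ a) = T.row a, MonoidAlgebra.of K (Equiv.Perm A) σ) *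
  (∑ τ : Equiv.Perm A with ∀ a, T.col (τ a) = T.col a,
    ((Equiv.Perm.sign τ : ℤ) : K) • MonoidAlgebra.of K (Equiv.Perm A) τ)

end Tableau

/-- A Young`^d_n` tableau of shape `μ`: a filling of the boxes of `μ` by elements of
`[n] = {0, …, n - 1}` in which every element of `[n]` occurs exactly `d` times. -/
structure DTableau (d n : ℕ) (μ : YoungDiagram) where
  entry : {c // c ∈ μ.cells} → Fin n
  card_entry : ∀ i, #{c | entry c = i} = d

namespace DTableau

/-- The partition `T ∘ F⁻¹` of `A` into the blocks `T (F⁻¹ i)`. -/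
def partition {d n : ℕ} {μ : YoungDiagram} (F : DTableau d n μ) {A : Type u} (T : Tableau μ A) :
    DPartition d A :=
  DPartition.mk' (Setoid.ker (F.entry ∘ T.symm)) (fun a => by
    have h : {b | (Setoid.ker (F.entry ∘ T.symm)) b a} =
        T '' (({c | F.entry c = F.entry (T.symm a)} : Finset _) : Set _) := by
      ext b
      simp [Setoid.ker_def, Equiv.image_eq_preimage_symm]
    rw [h, Set.ncard_image_of_injective _ T.injective, Set.ncard_coe_finset, F.card_entry])

/-- The element `t_F(A, T) = c(T) · z_{T ∘ F⁻¹}` of `Sym^(d)_A`. -/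
noncomputable def elt (K : Type w) [Field K] {d n : ℕ} {μ : YoungDiagram} (F : DTableau d n μ)
    {A : Type u} [Fintype A] [DecidableEq A] (T : Tableau μ A) : GenSym K d A :=
  (GenSym.rep K d A).asAlgebraHom (T.symmetrizer K) (Finsupp.single (F.partition T) 1)

/-- The tabloid `[F]`, i.e. the collection of all the elements `t_F(A, T)`. -/
def tabloid (K : Type w) [Field K] {d n : ℕ} {μ : YoungDiagram} (F : DTableau d n μ) :
    GenElements.{u} K d :=
  fun A _ => {x | ∃ (_ : Fintype A) (_ : DecidableEq A) (T : Tableau μ A), x = F.elt K T}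

end DTableau

/-! ### Graphs and their covariants -/

/-- A finite graph with vertices in `V`. Multiple edges between two vertices are allowed; an edge
joins two different vertices. -/
structure MGraph (V : Type v) where
  verts : Finset V
  edges : Multiset (Sym2 V)
  mem_verts : ∀ e ∈ edges, ∀ x ∈ e, x ∈ verts
  not_isDiag : ∀ e ∈ edges, ¬ e.IsDiag

namespace MGraph

/-- `Q'` is a subgraph of `Q`. -/
def IsSubgraph {V : Type v} (Q' Q : MGraph V) : Prop :=
  Q'.verts ⊆ Q.verts ∧ Q'.edges ≤ Q.edges

open Classical in
/-- The number of edges (with multiplicity) incident to a vertex. -/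
noncomputable def degree {V : Type v} (Q : MGraph V) (x : V) : ℕ :=
  Q.edges.countP (fun e => x ∈ e)

/-- Every vertex is incident to at most `d` edges. -/
def MaxDegreeLE {V : Type v} (Q : MGraph V) (d : ℕ) : Prop :=
  ∀ x ∈ Q.verts, Q.degree x ≤ d

end MGraph

/-- A possible choice in the construction of the covariant of a graph `Q` with `n` vertices and `e`
edges: a labelling of the vertices by `[n]` and a Young`^d_n` tableau of shape `(nd - e, e)` whose
columns of size two are, up to order, the edges of `Q`. -/
structure GraphTableau {V : Type v} (d : ℕ) (Q : MGraph V) where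
  label : {x // x ∈ Q.verts} ≃ Fin (#Q.verts)
  shape : YoungDiagram
  rowLen_zero : shape.rowLen 0 + Q.edges.card = #Q.verts * d
  rowLen_one : shape.rowLen 1 = Q.edges.card
  rowLen_two : shape.rowLen 2 = 0
  tableau : DTableau d (#Q.verts) shape
  edges_eq : univ.val.map (fun j : Fin (shape.rowLen 1) =>
    s((label.symm (tableau.entry ⟨(0, (j : ℕ)), YoungDiagram.mem_iff_lt_rowLen.2
          (j.2.trans_le (shape.rowLen_anti 0 1 zero_le_one))⟩) : V),
      (label.symm (tableau.entry ⟨(1, (j : ℕ)), YoungDiagram.mem_iff_lt_rowLen.2 j.2⟩) : V))) = Q.edges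

namespace GraphTableau

/-- The ideal generated by the graph covariant `[Q]`, built from a choice `F`. -/
noncomputable def ideal (K : Type w) [Field K] {V : Type v} {d : ℕ} {Q : MGraph V}
    (F : GraphTableau d Q) : GenIdeal.{u} K d :=
  GenIdeal.generatedBy (F.tableau.tabloid K)

end GraphTableau

/-- The ideal generated by the covariants `[R]` of the graphs `R` in a family `S` (those with at most
`d` edges at every vertex, for which the covariant exists), built from the choices `G`. -/
noncomputable def familyIdeal (K : Type w) [Field K] {V : Type v} {d : ℕ}
    (G : ∀ R : MGraph V, R.MaxDegreeLE d → GraphTableau d R) (S : Set (MGraph V)) :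
    GenIdeal.{u} K d :=
  GenIdeal.generatedBy fun A _ =>
    {x | ∃ R ∈ S, ∃ h : R.MaxDegreeLE d, x ∈ (G R h).tableau.tabloid K A}

/-- The graphs with the same vertices as `Q'`, containing all edges of `Q'`, and with at most as
many edges as `Q`. -/
def enlargements {V : Type v} (Q' Q : MGraph V) : Set (MGraph V) :=
  {R | R.verts = Q'.verts ∧ Q'.edges ≤ R.edges ∧ R.edges.card ≤ Q.edges.card}

namespace GraphTableau

theorem card_filter_getElem? {W : Type v} [BEq W] [LawfulBEq W] [DecidableEq W] (L : List W) (x : W) :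
    #{j ∈ range L.length | L[j]? = some x} = L.count x := by
  induction L using List.reverseRecOn with
  | nil => simp
  | append_singleton l a ih =>
    have h : ({j ∈ range l.length | (l ++ [a])[j]? = some x} : Finset ℕ) =
        {j ∈ range l.length | l[j]? = some x} := by
      refine Finset.filter_congr fun j hj => ?_
      rw [List.getElem?_append_left (by simpa using hj)]
    rw [List.length_append, List.length_singleton, range_add_one, Finset.filter_insert, h,
      List.count_append, ← ih]
    by_cases ha : a = x <;> simp [ha]

theorem exists_ends {W : Type v} (p : W → Prop) (m : Multiset (Sym2 W))
    (h : ∀ e ∈ m, ∀ x ∈ e, p x) :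
    ∃ l : List ({x // p x} × {x // p x}),
      ((l.map fun q => s((q.1 : W), (q.2 : W)) : List (Sym2 W)) : Multiset (Sym2 W)) = m := by
  induction m using Multiset.induction_on with
  | empty => exact ⟨[], rfl⟩
  | cons e m ih =>
    obtain ⟨l, hl⟩ := ih fun e' he' => h e' (Multiset.mem_cons_of_mem he')
    induction e using Sym2.ind with
    | _ x y =>
      have hx := h _ (Multiset.mem_cons_self _ _) x (by simp)
      have hy := h _ (Multiset.mem_cons_self _ _) y (by simp)
      exact ⟨(⟨x, hx⟩, ⟨y, hy⟩) :: l, by simp [← hl]⟩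

/-- A graph with at most `d` edges at every vertex has a covariant. -/
theorem nonempty_of_maxDegreeLE {V : Type v} {d : ℕ} (Q : MGraph V) (hQ : Q.MaxDegreeLE d) :
    Nonempty (GraphTableau d Q) := by
  classical
  obtain ⟨p, hp⟩ := exists_ends (· ∈ Q.verts) Q.edges Q.mem_verts
  have hcard : p.length = Q.edges.card := by rw [← hp]; simp
  have hdeg : ∀ x : {x // x ∈ Q.verts},
      (p.map Prod.fst).count x + (p.map Prod.snd).count x = Q.degree x := by
    intro x
    have hd := Q.not_isDiag
    have hcount : Q.degree x = Q.edges.countP (fun e => (x : V) ∈ e) := by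
      unfold MGraph.degree; congr
    rw [hcount]
    rw [← hp] at hd ⊢
    clear hp hcard hcount
    induction p with
    | nil => simp
    | cons q p ih =>
      have ih' := ih fun e he => hd e (by simp at he ⊢; tauto)
      have hq : q.1 ≠ q.2 := by
        have := hd s((q.1 : V), (q.2 : V)) (by simp)
        exact fun h => this (by rw [h]; exact Sym2.mk_isDiag_iff.2 rfl)
      simp only [Multiset.coe_countP, List.map_cons, List.count_cons, List.countP_cons] at ih' ⊢
      rw [← ih']
      by_cases h1 : q.1 = x <;> by_cases h2 : q.2 = x
      · exact absurd (h1.trans h2.symm) hq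
      all_goals
        have h1' : (x : V) = q.1 ↔ q.1 = x := by rw [Subtype.ext_iff]; exact eq_comm
        have h2' : (x : V) = q.2 ↔ q.2 = x := by rw [Subtype.ext_iff]; exact eq_comm
        simp only [Sym2.mem_iff, h1', h2', h1, h2, beq_iff_eq, if_true, if_false, or_self,
          or_true, or_false, decide_true, decide_false, Bool.false_eq_true]
        omega
  set S : List {x // x ∈ Q.verts} :=
    (univ : Finset {x // x ∈ Q.verts}).toList.flatMap
      (fun x : {x // x ∈ Q.verts} => List.replicate (d - Q.degree x) x) with hS
  have hSc : ∀ x, S.count x = d - Q.degree x := by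
    intro x
    rw [hS, List.count_flatMap, Finset.sum_map_toList]
    simp [Function.comp_def, List.count_replicate]
  set L0 := p.map Prod.fst ++ S with hL0
  set L1 := p.map Prod.snd with hL1
  have hL1len : L1.length = Q.edges.card := by simp [hL1, hcard]
  have hcnt : ∀ x, L0.count x + L1.count x = d := by
    intro x
    have := hdeg x
    have := hQ x x.2
    rw [hL0, List.count_append, hSc]
    omega
  have hlen : L0.length + L1.length = #Q.verts * d := by
    have h1 : ∀ L : List {x // x ∈ Q.verts}, L.length = ∑ x, L.count x := fun L => by
      have := Multiset.sum_count_eq_card (s := univ) (m := (L : Multiset {x // x ∈ Q.verts}))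
        (by simp)
      rw [Multiset.coe_card] at this
      rw [← this]
      refine Finset.sum_congr rfl fun x _ => ?_
      rw [Multiset.coe_count]
      congr!
    rw [h1 L0, h1 L1, ← Finset.sum_add_distrib, Finset.sum_congr rfl fun x _ => hcnt x]
    simp
  have hle : L1.length ≤ L0.length := by simp [hL0, hL1]
  let μ := YoungDiagram.ofRowLens [L0.length, L1.length] (by
    rw [List.sortedGE_iff_pairwise]; simpa using hle)
  have hcells : μ.cells = (range L0.length).image (fun j => (0, j)) ∪
      (range L1.length).image (fun j => (1, j)) := by
    ext ⟨i, j⟩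
    rw [YoungDiagram.mem_cells, YoungDiagram.mem_ofRowLens]
    rcases i with _ | _ | i <;> simp
  let g : ℕ × ℕ → Option {x // x ∈ Q.verts} := fun c => if c.1 = 0 then L0[c.2]? else L1[c.2]?
  have hg : ∀ c ∈ μ.cells, (g c).isSome := by
    intro c hc
    rw [hcells] at hc
    simp only [mem_union, mem_image, mem_range] at hc
    rcases hc with ⟨j, hj, rfl⟩ | ⟨j, hj, rfl⟩ <;> simp [g, hj]
  have hfib : ∀ x, #{c ∈ μ.cells | g c = some x} = d := by
    intro x
    rw [hcells, Finset.filter_union, Finset.card_union_of_disjoint, Finset.filter_image,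
      Finset.filter_image, Finset.card_image_of_injective, Finset.card_image_of_injective]
    · simp only [g, if_true, one_ne_zero, if_false]
      rw [card_filter_getElem?, card_filter_getElem?, hcnt]
    · exact fun a b h => by simpa using h
    · exact fun a b h => by simpa using h
    · rw [Finset.disjoint_left]
      rintro ⟨i, j⟩ h1 h2
      simp only [mem_filter, mem_image, Prod.mk.injEq] at h1 h2
      obtain ⟨⟨_, _, h1, _⟩, _⟩ := h1
      obtain ⟨⟨_, _, h2, _⟩, _⟩ := h2
      omega
  have hr0 : μ.rowLen 0 = L0.length := YoungDiagram.rowLen_ofRowLens ⟨0, by simp⟩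
  have hr1 : μ.rowLen 1 = L1.length := YoungDiagram.rowLen_ofRowLens ⟨1, by simp⟩
  refine ⟨⟨Q.verts.equivFin, μ, ?_, ?_, ?_, ⟨fun c => Q.verts.equivFin ((g c).get (hg c c.2)), ?_⟩,
    ?_⟩⟩
  · rw [hr0, ← hL1len, hlen]
  · rw [hr1, hL1len]
  · by_contra h
    have : (2, 0) ∈ μ := YoungDiagram.mem_iff_lt_rowLen.2 (Nat.pos_of_ne_zero h)
    rw [YoungDiagram.mem_ofRowLens] at this
    simp at this
  · intro i
    rw [← hfib (Q.verts.equivFin.symm i)]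
    refine Finset.card_bij (fun c _ => c.1) ?_ (fun _ _ _ _ h => Subtype.ext h) ?_
    · rintro ⟨c, hc⟩ h
      simp only [mem_filter, mem_univ, true_and] at h ⊢
      refine ⟨hc, ?_⟩
      rw [← h, Equiv.symm_apply_apply, Option.some_get]
    · intro c h
      simp only [mem_filter] at h
      refine ⟨⟨c, h.1⟩, ?_, rfl⟩
      simp [h.2]
  · rw [← hp]
    have : ∀ n (hn : n = p.length) (f : Fin n → Sym2 V)
        (_ : ∀ j : Fin n, f j = s(((p[(j : ℕ)]'(hn ▸ j.2)).1 : V), ((p[(j : ℕ)]'(hn ▸ j.2)).2 : V))),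
        (univ : Finset (Fin n)).val.map f = ((p.map fun q => s((q.1 : V), (q.2 : V)) : List _) :
          Multiset (Sym2 V)) := by
      rintro n rfl f hf
      rw [Fin.univ_val_map]
      congr 1
      refine List.ext_getElem (by simp) fun j h1 h2 => ?_
      simp [hf]
    refine this _ (by rw [hr1, hL1len, hcard]) _ fun j => ?_
    have hj : (j : ℕ) < p.length := j.2.trans_eq (by rw [hr1, hL1len, hcard])
    simp [g, hL0, hL1, List.getElem_append_left, hj]

end GraphTableau

/-! ### Products of differences, and functoriality of products of monomials -/

open MvPolynomial

/-! The Young symmetrizer is encoded by polynomials. For `z` over `A` and an exponent `m` on `B`,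
the polarization sends a polynomial `p` to the sum over bijections `ψ : A ≃ B` of the coefficient of
`x^m` in `ψ p`, times `ψ z`. For a two-rowed tableau with second row `m`, the column antisymmetrizer
turns `x^m` into the product of the differences `X_lower - X_upper` over the columns, and extracting
the coefficient of `x^m` is the row symmetrizer. So the covariant of a graph is the polarization of
one difference per edge (`DTableau.elt_eq_polar`). Conversely, such a polarization lies in any ideal
containing the covariant of the graph drawn by its pairs (`GraphTableau.polar_pairProd_mem`), and it
vanishes if a pair lies inside one block (`GenSym.polar_pairProd_eq_zero`).

In the product for `Q`, keep the differences `J` of the edges of `Q'` and expand all others into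
monomials. The variables in blocks outside `V(Q')` are then removed: averaging over the permutations
of the blocks of `V(Q')` exhibits the polarization as a combination of images of products, with
polarizations over `V(Q')` as first factors (`GenSym.polar_mul_mem`). What remains is a product of
the differences of `J` with a monomial in variables away from the points of `J`.

Such a monomial is traded for new edges (`GenSym.polar_pairProd_mul_mem`). Replacing a variable
`X_w` by `X_w - X_v` adds an edge. Summing over `v` leaves a multiple of the original term plus a
term with factor `∑ X_v`, which only lowers the degree of `m`. Points already used contribute
nothing to the sum, because squares have zero polarization when `m` is squarefree. By homogeneity
the final number of edges is the degree of some exponent below the original one, hence at most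
`|E(Q)|`. -/

/-- `∏ (X q - X p)` over the pairs `(p, q)` of a multiset. -/
noncomputable def pairProd (K : Type w) [Field K] {A : Type u} (L : Multiset (A × A)) :
    MvPolynomial A K :=
  (L.map fun x => X x.2 - X x.1).prod

/-- The multiset of all members of the pairs in a multiset. -/
def pairPoints {A : Type u} (L : Multiset (A × A)) : Multiset A :=
  L.map Prod.fst + L.map Prod.snd

namespace DPartition

variable {d : ℕ} {A B : Type u} {P : DPartition d A} {R : DPartition d B}

theorem disjUnion_inl_inl {a a' : A} : (P.disjUnion R).1 (Sum.inl a) (Sum.inl a') ↔ P.1 a a' :=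
  Sum.liftRel_inl_inl

theorem disjUnion_inr_inr {b b' : B} : (P.disjUnion R).1 (Sum.inr b) (Sum.inr b') ↔ R.1 b b' :=
  Sum.liftRel_inr_inr

theorem not_disjUnion_inl_inr {a : A} {b : B} : ¬ (P.disjUnion R).1 (Sum.inl a) (Sum.inr b) :=
  Sum.not_liftRel_inl_inr

theorem not_disjUnion_inr_inl {a : A} {b : B} : ¬ (P.disjUnion R).1 (Sum.inr b) (Sum.inl a) :=
  Sum.not_liftRel_inr_inl

end DPartition

namespace GenSym

variable {K : Type w} [Field K] {d : ℕ} {A B C : Type u}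

theorem map_trans (φ : A ≃ B) (ψ : B ≃ C) (z : GenSym K d A) :
    map K d (φ.trans ψ) z = map K d ψ (map K d φ z) := by
  unfold map
  rw [show DPartition.map (d := d) (φ.trans ψ) = DPartition.map ψ ∘ DPartition.map φ from rfl,
    Finsupp.lmapDomain_comp]
  rfl

theorem map_single (φ : A ≃ B) (P : DPartition d A) (k : K) :
    map K d φ (Finsupp.single P k) = Finsupp.single (P.map φ) k := by
  simp [map]

theorem mul_single (P : DPartition d A) (R : DPartition d B) (k l : K) :
    mul K d (Finsupp.single P k) (Finsupp.single R l) =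
      Finsupp.single (P.disjUnion R) (k * l) := by
  simp [mul]

theorem map_sumCongr_mul {A₁ A₂ B₁ B₂ : Type u} (φ : A₁ ≃ B₁) (ψ : A₂ ≃ B₂)
    (x : GenSym K d A₁) (y : GenSym K d A₂) :
    map K d (Equiv.sumCongr φ ψ) (mul K d x y) = mul K d (map K d φ x) (map K d ψ y) := by
  induction x using Finsupp.induction_linear with
  | zero => simp
  | add x x' hx hx' => simp only [_root_.map_add, LinearMap.add_apply, hx, hx']
  | single P k =>
    induction y using Finsupp.induction_linear with
    | zero => simp
    | add y y' hy hy' => simp only [_root_.map_add, hy, hy']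
    | single R l =>
      rw [mul_single, map_single, map_single, map_single, mul_single]
      congr 1
      refine Subtype.ext (Setoid.ext ?_)
      rintro (a | a) (b | b)
      · exact DPartition.disjUnion_inl_inl.trans
          (DPartition.disjUnion_inl_inl (P := P.map φ) (R := R.map ψ)).symm
      · exact iff_of_false DPartition.not_disjUnion_inl_inr DPartition.not_disjUnion_inl_inr
      · exact iff_of_false DPartition.not_disjUnion_inr_inl DPartition.not_disjUnion_inr_inl
      · exact DPartition.disjUnion_inr_inr.trans
          (DPartition.disjUnion_inr_inr (P := P.map φ) (R := R.map ψ)).symm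

/-! ### Polarization and its formal rules -/

variable [Fintype A] [DecidableEq A] [Fintype B] [DecidableEq B] [Fintype C] [DecidableEq C]

/-- The polarization `p ↦ ∑_ψ [x^m] ψ(p) • ψ(z)`, the sum being over all bijections `ψ : A ≃ B`. -/
noncomputable def polar (m : B →₀ ℕ) (z : GenSym K d A) :
    MvPolynomial A K →ₗ[K] GenSym K d B :=
  ∑ ψ : A ≃ B, ((MvPolynomial.lcoeff K m).comp (MvPolynomial.rename ψ).toLinearMap).smulRight
    (map K d ψ z)

theorem polar_apply (m : B →₀ ℕ) (z : GenSym K d A) (p : MvPolynomial A K) :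
    polar m z p = ∑ ψ : A ≃ B, (MvPolynomial.rename ψ p).coeff m • map K d ψ z := by
  simp [polar, LinearMap.sum_apply]

/-- Reindexing the sum by `ψ ↦ φ⁻¹ ψ` absorbs a bijection applied to both arguments. This moves
group elements between `z` and `p`. -/
theorem polar_rename (φ : A ≃ C) (m : B →₀ ℕ) (z : GenSym K d A) (p : MvPolynomial A K) :
    polar m (map K d φ z) (MvPolynomial.rename φ p) = polar m z p := by
  rw [polar_apply, polar_apply, ← Equiv.sum_comp (Equiv.equivCongr φ (Equiv.refl B))]
  refine sum_congr rfl fun ψ _ => ?_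
  rw [MvPolynomial.rename_rename, ← map_trans]
  congr! 3
  · ext; simp
  · ext; simp

theorem map_polar (φ : B ≃ C) (m : B →₀ ℕ) (z : GenSym K d A) (p : MvPolynomial A K) :
    map K d φ (polar m z p) = polar (m.mapDomain φ) z p := by
  rw [polar_apply, polar_apply, ← Equiv.sum_comp (Equiv.equivCongr (Equiv.refl A) φ), map_sum]
  refine sum_congr rfl fun ψ _ => ?_
  rw [map_smul, ← map_trans, show ((Equiv.refl A).equivCongr φ) ψ = ψ.trans φ from rfl,
    Equiv.coe_trans, ← MvPolynomial.rename_rename,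
    MvPolynomial.coeff_rename_mapDomain _ φ.injective]

/-- Under every bijection a square of a variable divides the polynomial, so no squarefree monomial
occurs in it. -/
theorem polar_X_mul_X_mul {m : B →₀ ℕ} (hm : ∀ b, m b ≤ 1) (z : GenSym K d A) (a : A)
    (p : MvPolynomial A K) : polar m z (X a * (X a * p)) = 0 := by
  rw [polar_apply]
  refine sum_eq_zero fun ψ _ => ?_
  rw [map_mul, map_mul, rename_X, coeff_X_mul', coeff_X_mul']
  have := hm (ψ a)
  rw [if_neg (c := ψ a ∈ Finsupp.support (m - Finsupp.single (ψ a) 1)), ite_self, zero_smul]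
  rw [Finsupp.notMem_support_iff, Finsupp.tsub_apply, Finsupp.single_eq_same]
  omega

/-- The sum of all variables is carried by every bijection to the sum of all variables of `B`, and
multiplying by `X_b` shifts exponents by one at `b`. -/
theorem polar_sum_X_mul {m : B →₀ ℕ} (z : GenSym K d A)
    (p : MvPolynomial A K) :
    polar m z ((∑ a, X a) * p) = ∑ b ∈ m.support, polar (m - Finsupp.single b 1) z p := by
  simp only [polar_apply]
  rw [sum_comm]
  refine sum_congr rfl fun ψ _ => ?_
  rw [← sum_smul, map_mul, map_sum, sum_mul, coeff_sum]
  simp only [rename_X]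
  rw [Equiv.sum_comp ψ fun b => coeff m (X b * rename ψ p)]
  simp only [coeff_X_mul']
  rw [← sum_filter]
  congr 2
  ext; simp

theorem polar_eq_zero_of_degree_ne {m : B →₀ ℕ} (z : GenSym K d A) {p : MvPolynomial A K} {k : ℕ}
    (hp : p.IsHomogeneous k) (hk : m.degree ≠ k) : polar m z p = 0 := by
  rw [polar_apply]
  refine sum_eq_zero fun ψ _ => ?_
  rw [(hp.rename_isHomogeneous (f := ψ)).coeff_eq_zero hk, zero_smul]

end GenSym

theorem pairProd_cons (K : Type w) [Field K] {A : Type u} (x : A × A) (L : Multiset (A × A)) :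
    pairProd K (x ::ₘ L) = (X x.2 - X x.1) * pairProd K L := by
  simp [pairProd]

theorem pairPoints_cons {A : Type u} (x : A × A) (L : Multiset (A × A)) :
    pairPoints (x ::ₘ L) = x.1 ::ₘ x.2 ::ₘ pairPoints L := by
  simp [pairPoints, Multiset.cons_swap x.1]

theorem mem_pairPoints {A : Type u} {L : Multiset (A × A)} {a : A} :
    a ∈ pairPoints L ↔ ∃ x ∈ L, x.1 = a ∨ x.2 = a := by
  simp only [pairPoints, Multiset.mem_add, Multiset.mem_map]
  aesop

theorem pairProd_isHomogeneous (K : Type w) [Field K] {A : Type u} (L : Multiset (A × A)) :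
    (pairProd K L).IsHomogeneous L.card := by
  induction L using Multiset.induction_on with
  | empty => simpa [pairProd] using isHomogeneous_one A K
  | cons x L ih =>
    rw [pairProd_cons, Multiset.card_cons, add_comm]
    exact ((isHomogeneous_X K _).sub (isHomogeneous_X K _)).mul ih

/-! ### Trading variables for pairs, and restricting to a factor -/

namespace GenSym

variable {K : Type w} [Field K] {d : ℕ} {A B C : Type u}
variable [Fintype A] [DecidableEq A] [Fintype B] [DecidableEq B]

/-- The two ends of one pair contribute `(X_q + X_p)(X_q - X_p) = X_q² - X_p²`, and squares have
zero polarization. -/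
theorem sum_polar_pairPoints {m : B →₀ ℕ} (hm : ∀ b, m b ≤ 1) (z : GenSym K d A)
    (L : Multiset (A × A)) (p : MvPolynomial A K) :
    ((pairPoints L).map fun v => polar m z (X v * (pairProd K L * p))).sum = 0 := by
  have key : ∀ x ∈ L, polar m z (X x.1 * (pairProd K L * p)) +
      polar m z (X x.2 * (pairProd K L * p)) = 0 := by
    intro x hx
    obtain ⟨L', rfl⟩ := Multiset.exists_cons_of_mem hx
    rw [← map_add, pairProd_cons, show X x.1 * ((X x.2 - X x.1) * pairProd K L' * p) +
        X x.2 * ((X x.2 - X x.1) * pairProd K L' * p) = X x.2 * (X x.2 * (pairProd K L' * p)) -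
        X x.1 * (X x.1 * (pairProd K L' * p)) by ring, map_sub, polar_X_mul_X_mul hm,
      polar_X_mul_X_mul hm, sub_zero]
  rw [pairPoints, Multiset.map_add, Multiset.sum_add, Multiset.map_map, Multiset.map_map,
    ← Multiset.sum_map_add]
  exact Multiset.sum_eq_zero (by simpa using fun x a b hab h => h ▸ key (a, b) hab)

/-- Membership of all polarizations of products of pairs extending `J` propagates to the products
of pairs with monomials in the remaining variables. -/
theorem polar_pairProd_mul_mem [CharZero K] (N : Submodule K (GenSym K d B)) (z : GenSym K d A)
    (e : ℕ) (J : Multiset (A × A))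
    (H : ∀ L, J ≤ L → (pairPoints L).Nodup → L.card ≤ e → ∀ m : B →₀ ℕ, (∀ b, m b ≤ 1) →
      m.degree = L.card → polar m z (pairProd K L) ∈ N) (W : Multiset A) :
    ∀ L, J ≤ L → (pairPoints L).Nodup → Disjoint (pairPoints L) W → ∀ m : B →₀ ℕ,
      (∀ b, m b ≤ 1) → m.degree ≤ e → polar m z (pairProd K L * (W.map X).prod) ∈ N := by
  induction W using Multiset.induction_on with
  | empty =>
    intro L hJ hL _ m hm he
    rw [Multiset.map_zero, Multiset.prod_zero, mul_one]
    by_cases hc : m.degree = L.card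
    · exact H L hJ hL (hc ▸ he) m hm hc
    · rw [polar_eq_zero_of_degree_ne z (pairProd_isHomogeneous K L) hc]
      exact N.zero_mem
  | cons w W ih =>
    intro L hJ hL hd m hm he
    rw [Multiset.disjoint_cons_right] at hd
    obtain ⟨hw, hd⟩ := hd
    set f : A → GenSym K d B := fun v => polar m z (X v * (pairProd K L * (W.map X).prod)) with hf
    have hW : ∀ v ∈ W, f v = 0 := by
      intro v hv
      obtain ⟨W', rfl⟩ := Multiset.exists_cons_of_mem hv
      simp only [hf, Multiset.map_cons, Multiset.prod_cons]
      rw [mul_left_comm (pairProd K L), polar_X_mul_X_mul hm]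
    rw [Multiset.map_cons, Multiset.prod_cons, mul_left_comm]
    change f w ∈ N
    by_cases hwW : w ∈ W
    · rw [hW w hwW]; exact N.zero_mem
    set s := (pairPoints L).toFinset with hs
    -- The factor `∑ X_v` is removed at the price of lowering `m`; this is why the induction allows
    -- every degree up to `e`.
    have hsum : ∑ v, f v ∈ N := by
      rw [hf, ← map_sum, ← sum_mul, polar_sum_X_mul]
      refine N.sum_mem fun b hb => ih L hJ hL hd _ (fun b' => ?_) ?_
      · exact (Nat.sub_le _ _).trans (hm b')
      · refine le_trans ?_ he
        have : m - Finsupp.single b 1 ≤ m := tsub_le_self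
        rw [Finsupp.degree_eq_sum, Finsupp.degree_eq_sum]
        exact sum_le_sum fun i _ => this i
    have hs0 : ∑ v ∈ s, f v = 0 := by
      rw [← sum_polar_pairPoints hm z L (W.map X).prod, hs, Finset.sum, Multiset.toFinset_val,
        hL.dedup]
    -- The factor `X_w - X_v` is a new pair `(v, w)`, disjoint from the points of `L` and from `W`,
    -- so one fewer free variable is left.
    have hU : ∀ v ∈ univ \ s, v ∉ W → f w - f v ∈ N := by
      intro v hv hvW
      have hvL : v ∉ pairPoints L := by simpa [hs] using hv
      by_cases hvw : v = w
      · rw [hvw, sub_self]; exact N.zero_mem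
      have := ih ((v, w) ::ₘ L) (hJ.trans (Multiset.le_cons_self _ _)) (by
        rw [pairPoints_cons]
        simp [hL, hvL, hw, hvw]) (by
        rw [pairPoints_cons, Multiset.disjoint_cons_left, Multiset.disjoint_cons_left]
        exact ⟨hvW, hwW, hd⟩) m hm he
      rw [pairProd_cons] at this
      convert this using 1
      simp only [hf]
      rw [← map_sub]
      congr 1
      ring
    -- Summing the differences over the unused points `v` gives this multiple of `f w` minus the
    -- total sum, since used points contribute nothing. The count is nonzero because `w` itself is
    -- unused.
    have hsplit : ((#({v ∈ univ \ s | v ∉ W}) : ℕ) : K) • f w ∈ N := by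
      have h1 : ∑ v ∈ univ \ s with v ∉ W, f v = ∑ v, f v := by
        rw [← sum_sdiff (subset_univ s), hs0, add_zero, sum_filter]
        refine sum_congr rfl fun v _ => ?_
        by_cases hv : v ∈ W <;> simp [hv, hW]
      have h2 : ((#({v ∈ univ \ s | v ∉ W}) : ℕ) : K) • f w =
          (∑ v ∈ univ \ s with v ∉ W, (f w - f v)) + ∑ v, f v := by
        rw [sum_sub_distrib, h1, sum_const, Nat.cast_smul_eq_nsmul, sub_add_cancel]
      rw [h2]
      refine N.add_mem (N.sum_mem fun v hv => ?_) hsum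
      rw [mem_filter] at hv
      exact hU v hv.1 hv.2
    refine (N.smul_mem_iff ?_).1 hsplit
    rw [Nat.cast_ne_zero]
    refine (card_pos.2 ⟨w, ?_⟩).ne'
    simp [hs, hw, hwW]

theorem coeff_rename_inl_mul_rename_inr {A₁ A₂ : Type u} [Finite A₁] [Finite A₂]
    (p : MvPolynomial A₁ K) (q : MvPolynomial A₂ K) (m : A₁ ⊕ A₂ →₀ ℕ) :
    (rename Sum.inl p * rename Sum.inr q).coeff m =
      p.coeff (m.comapDomain Sum.inl Sum.inl_injective.injOn) *
        q.coeff (m.comapDomain Sum.inr Sum.inr_injective.injOn) := by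
  classical
  induction p using MvPolynomial.induction_on' with
  | add p p' hp hp' => simp only [map_add, add_mul, coeff_add, hp, hp']
  | monomial s a =>
    induction q using MvPolynomial.induction_on' with
    | add p p' hp hp' => simp only [map_add, mul_add, coeff_add, hp, hp']
    | monomial t b =>
      rw [rename_monomial, rename_monomial, monomial_mul, coeff_monomial, coeff_monomial,
        coeff_monomial, ite_zero_mul_ite_zero]
      refine if_congr ?_ rfl rfl
      constructor
      · rintro rfl
        constructor
        · ext i
          simp [Finsupp.comapDomain_apply, Finsupp.mapDomain_apply Sum.inl_injective,
            Finsupp.mapDomain_of_notMem_range]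
        · ext i
          simp [Finsupp.comapDomain_apply, Finsupp.mapDomain_apply Sum.inr_injective,
            Finsupp.mapDomain_of_notMem_range]
      · rintro ⟨rfl, rfl⟩
        ext (i | i)
        · simp [Finsupp.comapDomain_apply, Finsupp.mapDomain_apply Sum.inl_injective,
            Finsupp.mapDomain_of_notMem_range]
        · simp [Finsupp.comapDomain_apply, Finsupp.mapDomain_apply Sum.inr_injective,
            Finsupp.mapDomain_of_notMem_range]

/-- Polarizations of a product lie in an ideal as soon as those of the first factor do. -/
theorem polar_mul_mem [CharZero K] (I : GenIdeal.{u} K d) {A₁ A₂ : Type u} [Fintype A₁]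
    [Fintype A₂] [DecidableEq A₁] [DecidableEq A₂] {m : B →₀ ℕ} (hm : ∀ b, m b ≤ 1)
    (z₁ : GenSym K d A₁) (z₂ : GenSym K d A₂) (p : MvPolynomial A₁ K) (q : MvPolynomial A₂ K)
    (H : ∀ m' : A₁ →₀ ℕ, (∀ a, m' a ≤ 1) → m'.degree ≤ m.degree → polar m' z₁ p ∈ I.carrier A₁) :
    polar m (mul K d z₁ z₂) (rename Sum.inl p * rename Sum.inr q) ∈ I.carrier B := by
  set x := polar m (mul K d z₁ z₂) (rename Sum.inl p * rename Sum.inr q) with hx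
  let cl : (A₁ ⊕ A₂ ≃ B) → (A₁ →₀ ℕ) := fun ψ =>
    (m.comapDomain ψ ψ.injective.injOn).comapDomain Sum.inl Sum.inl_injective.injOn
  let cr : (A₁ ⊕ A₂ ≃ B) → (A₂ →₀ ℕ) := fun ψ =>
    (m.comapDomain ψ ψ.injective.injOn).comapDomain Sum.inr Sum.inr_injective.injOn
  -- Precomposing every `ψ` with a permutation `ρ` of the first summand does not change the sum.
  -- Pulling `m` back along `ψ` splits the coefficient into one for `p` and one for `q`.
  have h1 : ∀ ρ : A₁ ≃ A₁, x = ∑ ψ : A₁ ⊕ A₂ ≃ B,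
      ((rename ρ p).coeff (cl ψ) * q.coeff (cr ψ)) • map K d ψ (mul K d (map K d ρ z₁) z₂) := by
    intro ρ
    rw [hx, ← polar_rename (Equiv.sumCongr ρ (Equiv.refl A₂)), polar_apply, map_sumCongr_mul,
      show map K d (Equiv.refl A₂) z₂ = z₂ from congrArg (· z₂) (Finsupp.lmapDomain_id K K)]
    refine sum_congr rfl fun ψ _ => ?_
    congr 1
    have hmm : m = (m.comapDomain ψ ψ.injective.injOn).mapDomain ψ :=
      (Finsupp.mapDomain_comapDomain _ ψ.injective _ (by simp)).symm
    conv_lhs => rw [hmm]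
    rw [coeff_rename_mapDomain _ ψ.injective, map_mul, rename_rename, rename_rename,
      ← coeff_rename_inl_mul_rename_inr, rename_rename]
    rfl
  -- Summing over all `ρ` with `ψ` fixed, the first factor becomes a full polarization over `A₁`.
  have h2 : ((Fintype.card (A₁ ≃ A₁) : ℕ) : K) • x = ∑ ψ : A₁ ⊕ A₂ ≃ B,
      q.coeff (cr ψ) • map K d ψ (mul K d (polar (cl ψ) z₁ p) z₂) := by
    rw [Nat.cast_smul_eq_nsmul, ← card_univ, ← sum_const, sum_congr rfl fun ρ _ => h1 ρ, sum_comm]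
    refine sum_congr rfl fun ψ _ => ?_
    rw [polar_apply, map_sum, LinearMap.sum_apply, map_sum, smul_sum]
    refine sum_congr rfl fun ρ _ => ?_
    rw [map_smul, LinearMap.smul_apply, map_smul, smul_smul, mul_comm]
  have h0 : ((Fintype.card (A₁ ≃ A₁) : ℕ) : K) ≠ 0 := Nat.cast_ne_zero.2 Fintype.card_ne_zero
  refine ((I.carrier B).smul_mem_iff h0).1 ?_
  rw [h2]
  refine (I.carrier B).sum_mem fun ψ _ => (I.carrier B).smul_mem _ <| I.map_mem _ _ _ _ <|
    I.mul_mem _ _ _ _ <| H _ (fun a => hm _) ?_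
  rw [Finsupp.degree_eq_sum, Finsupp.degree_eq_sum, ← Equiv.sum_comp ψ, Fintype.sum_sum_type]
  exact Nat.le_add_right _ _

end GenSym

/-! ### Two-rowed tableaux: Young symmetrizers as polarizations -/

namespace YoungDiagram

/-- The upper box of a column of size at least two. -/
def upperBox (μ : YoungDiagram) (j : Fin (μ.rowLen 1)) : {c // c ∈ μ.cells} :=
  ⟨(0, (j : ℕ)), YoungDiagram.mem_iff_lt_rowLen.2 (j.2.trans_le (μ.rowLen_anti 0 1 zero_le_one))⟩

/-- The second box of a column of size at least two. -/
def lowerBox (μ : YoungDiagram) (j : Fin (μ.rowLen 1)) : {c // c ∈ μ.cells} :=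
  ⟨(1, (j : ℕ)), YoungDiagram.mem_iff_lt_rowLen.2 j.2⟩

theorem elim_upperBox_lowerBox_injective (μ : YoungDiagram) :
    Function.Injective (Sum.elim μ.upperBox μ.lowerBox) := by
  rintro (i | i) (j | j) h <;>
  simp_all [upperBox, lowerBox, Fin.ext_iff]

theorem eq_lowerBox_of_fst_eq_one {μ : YoungDiagram} (c : {c // c ∈ μ.cells}) (h : c.1.1 = 1) :
    ∃ j, c = μ.lowerBox j := by
  obtain ⟨⟨i, j⟩, hc⟩ := c
  obtain rfl : i = 1 := h
  exact ⟨⟨j, YoungDiagram.mem_iff_lt_rowLen.1 hc⟩, rfl⟩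

theorem fst_lt_two_of_rowLen_two {μ : YoungDiagram} (h2 : μ.rowLen 2 = 0)
    (c : {c // c ∈ μ.cells}) : c.1.1 < 2 := by
  obtain ⟨⟨i, j⟩, hc⟩ := c
  by_contra! h
  have h3 := YoungDiagram.mem_iff_lt_rowLen.1 hc
  have := μ.rowLen_anti 2 i h
  omega

end YoungDiagram

section ColumnGroup

variable {A : Type u} [Fintype A] [DecidableEq A] {ι : Type*}

/-- The permutations that preserve each of the pairs `{p j, q j}`, `j ∈ J`, and fix all other
points. -/
def pairStabilizer (p q : ι → A) (J : Finset ι) : Finset (Equiv.Perm A) :=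
  {τ | ∀ a, τ a = a ∨ ∃ j ∈ J, (a = p j ∨ a = q j) ∧ (τ a = p j ∨ τ a = q j)}

variable {p q : ι → A} {J : Finset ι} {j : ι}

theorem pairStabilizer_apply_of_notMem (h : Function.Injective (Sum.elim p q)) (hj : j ∉ J)
    {τ : Equiv.Perm A} (hτ : τ ∈ pairStabilizer p q J) : τ (p j) = p j ∧ τ (q j) = q j := by
  obtain ⟨hp, hq, hpq⟩ := Sum.elim_injective.1 h
  simp only [pairStabilizer, mem_filter, mem_univ, true_and] at hτ
  constructor
  · rcases hτ (p j) with h1 | ⟨i, hi, h1 | h1, -⟩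
    · exact h1
    · exact absurd (hp h1 ▸ hi) hj
    · exact absurd h1 (hpq _ _)
  · rcases hτ (q j) with h1 | ⟨i, hi, h1 | h1, -⟩
    · exact h1
    · exact absurd h1.symm (hpq _ _)
    · exact absurd (hq h1 ▸ hi) hj

/-- An element of the larger group either fixes both points of the new pair or exchanges them, and
the swap undoes the exchange. -/
theorem mem_pairStabilizer_insert [DecidableEq ι] (h : Function.Injective (Sum.elim p q)) (hj : j ∉ J)
    {τ : Equiv.Perm A} : τ ∈ pairStabilizer p q (insert j J) ↔
      τ ∈ pairStabilizer p q J ∨ τ * Equiv.swap (p j) (q j) ∈ pairStabilizer p q J := by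
  have hmono : pairStabilizer p q J ⊆ pairStabilizer p q (insert j J) := by
    intro τ hτ
    simp only [pairStabilizer, mem_filter, mem_univ, true_and] at hτ ⊢
    exact fun a => (hτ a).imp_right fun ⟨i, hi, h⟩ => ⟨i, mem_insert_of_mem hi, h⟩
  obtain ⟨hp, hq, hpq⟩ := Sum.elim_injective.1 h
  constructor
  · intro hτ
    simp only [pairStabilizer, mem_filter, mem_univ, true_and] at hτ
    have hoff : ∀ a, a ≠ p j → a ≠ q j →
        τ a = a ∨ ∃ i ∈ J, (a = p i ∨ a = q i) ∧ (τ a = p i ∨ τ a = q i) := by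
      intro a h1 h2
      refine (hτ a).imp_right fun ⟨i, hi, h3, h4⟩ => ⟨i, ?_, h3, h4⟩
      refine (mem_insert.1 hi).resolve_left ?_
      rintro rfl
      tauto
    have h1 : τ (p j) = p j ∨ τ (p j) = q j := by
      rcases hτ (p j) with h1 | ⟨i, hi, h1 | h1, h2⟩
      · exact .inl h1
      · exact hp h1 ▸ h2
      · exact absurd h1 (hpq _ _)
    have h2 : τ (q j) = p j ∨ τ (q j) = q j := by
      rcases hτ (q j) with h1 | ⟨i, hi, h1 | h1, h2⟩
      · exact .inr h1
      · exact absurd h1.symm (hpq _ _)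
      · exact hq h1 ▸ h2
    have h3 : τ (p j) ≠ τ (q j) := fun h => hpq _ _ (τ.injective h)
    simp only [pairStabilizer, mem_filter, mem_univ, true_and, Equiv.Perm.mul_apply]
    rcases h1 with h1 | h1
    · refine .inl fun a => ?_
      by_cases ha : a = p j
      · exact .inl (by rw [ha, h1])
      by_cases hb : a = q j
      · exact .inl (by rw [hb]; exact h2.resolve_left fun h => h3 (h1.trans h.symm))
      exact hoff a ha hb
    · refine .inr fun a => ?_
      by_cases ha : a = p j
      · rw [ha, Equiv.swap_apply_left]
        exact .inl (h2.resolve_right fun h => h3 (h1.trans h.symm))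
      by_cases hb : a = q j
      · rw [hb, Equiv.swap_apply_right]
        exact .inl h1
      rw [Equiv.swap_apply_of_ne_of_ne ha hb]
      exact hoff a ha hb
  · rintro (hτ | hτ)
    · exact hmono hτ
    · obtain ⟨h1, h2⟩ := pairStabilizer_apply_of_notMem h hj hτ
      rw [Equiv.Perm.mul_apply, Equiv.swap_apply_left] at h1
      rw [Equiv.Perm.mul_apply, Equiv.swap_apply_right] at h2
      have hτ' := hmono hτ
      simp only [pairStabilizer, mem_filter, mem_univ, true_and, Equiv.Perm.mul_apply] at hτ' ⊢
      intro a
      by_cases ha : a = p j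
      · exact .inr ⟨j, mem_insert_self _ _, .inl ha, .inr (ha ▸ h2)⟩
      by_cases hb : a = q j
      · exact .inr ⟨j, mem_insert_self _ _, .inr hb, .inl (hb ▸ h1)⟩
      simpa [Equiv.swap_apply_of_ne_of_ne ha hb] using hτ' a

theorem sum_pairStabilizer_insert [DecidableEq ι] (h : Function.Injective (Sum.elim p q)) (hj : j ∉ J)
    {M : Type*} [AddCommMonoid M] (f : Equiv.Perm A → M) :
    ∑ τ ∈ pairStabilizer p q (insert j J), f τ =
      ∑ τ ∈ pairStabilizer p q J, (f τ + f (τ * Equiv.swap (p j) (q j))) := by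
  obtain ⟨hp, hq, hpq⟩ := Sum.elim_injective.1 h
  have h1 : pairStabilizer p q (insert j J) = pairStabilizer p q J ∪
      (pairStabilizer p q J).image (· * Equiv.swap (p j) (q j)) := by
    ext τ
    rw [mem_pairStabilizer_insert h hj, mem_union, mem_image]
    refine or_congr_right ⟨fun hτ => ⟨_, hτ, by simp [mul_assoc]⟩, ?_⟩
    rintro ⟨σ, hσ, rfl⟩
    simpa [mul_assoc] using hσ
  rw [h1, sum_union, sum_image (fun _ _ _ _ h => mul_right_cancel h), sum_add_distrib]
  rw [disjoint_left]
  intro τ h2 h3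
  obtain ⟨σ, hσ, rfl⟩ := mem_image.1 h3
  have h4 := (pairStabilizer_apply_of_notMem h hj h2).1
  rw [Equiv.Perm.mul_apply, Equiv.swap_apply_left,
    (pairStabilizer_apply_of_notMem h hj hσ).2] at h4
  exact hpq _ _ h4.symm

/-- The signed sum of a product of variables over a column group is a product of differences. -/
theorem sum_sign_smul_rename_prod [DecidableEq ι] (K : Type w) [Field K] (h : Function.Injective (Sum.elim p q))
    (J : Finset ι) : ∀ g : MvPolynomial A K, (∀ τ ∈ pairStabilizer p q J, rename τ g = g) →
    ∑ τ ∈ pairStabilizer p q J,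
      ((Equiv.Perm.sign τ : ℤ) : K) • rename τ ((∏ i ∈ J, X (q i)) * g) =
        (∏ i ∈ J, (X (q i) - X (p i))) * g := by
  obtain ⟨hp, hq, hpq⟩ := Sum.elim_injective.1 h
  induction J using Finset.induction_on with
  | empty =>
    intro g _
    have : pairStabilizer p q ∅ = {1} := by
      ext τ
      simp [pairStabilizer, Equiv.ext_iff]
    simp [this]
  | insert j J hj ih =>
    intro g hg
    have hsw : rename (Equiv.swap (p j) (q j)) g = g := by
      refine hg _ ((mem_pairStabilizer_insert h hj).2 (.inr ?_))
      simp [pairStabilizer]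
    have hg' : ∀ τ ∈ pairStabilizer p q J, rename τ g = g := fun τ hτ =>
      hg τ ((mem_pairStabilizer_insert h hj).2 (.inl hτ))
    have hprod : rename (Equiv.swap (p j) (q j)) (∏ i ∈ J, X (q i) : MvPolynomial A K) =
        ∏ i ∈ J, X (q i) := by
      rw [map_prod]
      refine prod_congr rfl fun i hi => ?_
      rw [rename_X, Equiv.swap_apply_of_ne_of_ne (hpq _ _).symm]
      exact fun hij => hj (hq hij ▸ hi)
    have key : ∀ τ : Equiv.Perm A,
        rename (τ * Equiv.swap (p j) (q j) : Equiv.Perm A) ((∏ i ∈ insert j J, X (q i)) * g) =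
          rename τ (X (p j) * (∏ i ∈ J, X (q i)) * g) := by
      intro τ
      rw [Equiv.Perm.coe_mul, ← rename_rename, prod_insert hj, map_mul (rename _), hsw,
        map_mul (rename (Equiv.swap _ _)), rename_X, Equiv.swap_apply_right, hprod]
    -- Each coset of the swap contributes the factor `X (q j) - X (p j)`. It is invariant under the
    -- smaller group, so it can join `g` in the induction hypothesis.
    rw [sum_pairStabilizer_insert h hj, prod_insert hj (f := fun i => X (q i) - X (p i)),
      mul_comm (X (q j) - X (p j)), mul_assoc, ← ih]
    · refine sum_congr rfl fun τ hτ => ?_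
      rw [key τ, Equiv.Perm.sign_mul, Equiv.Perm.sign_swap (hpq _ _), prod_insert hj]
      simp only [Units.val_neg, mul_neg, mul_one, Int.cast_neg,
        neg_smul]
      rw [← sub_eq_add_neg, ← smul_sub, ← map_sub]
      congr 2
      ring
    · intro τ hτ
      obtain ⟨h1, h2⟩ := pairStabilizer_apply_of_notMem h hj hτ
      rw [map_mul, map_sub, rename_X, rename_X, h1, h2, hg' τ hτ]

end ColumnGroup

namespace Tableau

variable {μ : YoungDiagram} {A : Type u}

/-- The columns of size at least two of a tableau, as pairs of entries of the first two rows. -/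
def columnPairs (T : Tableau μ A) : Multiset (A × A) :=
  univ.val.map fun j => (T (μ.upperBox j), T (μ.lowerBox j))

theorem elim_injective (T : Tableau μ A) :
    Function.Injective (Sum.elim (fun j => T (μ.upperBox j)) fun j => T (μ.lowerBox j)) := by
  rw [show Sum.elim (fun j => T (μ.upperBox j)) (fun j => T (μ.lowerBox j)) =
    T ∘ Sum.elim μ.upperBox μ.lowerBox by ext (j | j) <;> rfl]
  exact T.injective.comp μ.elim_upperBox_lowerBox_injective

variable [Fintype A]

/-- The indicator function of the second row of a tableau. -/
noncomputable def secondRow (T : Tableau μ A) : A →₀ ℕ :=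
  Finsupp.equivFunOnFinite.symm fun a => if T.row a = 1 then 1 else 0

theorem secondRow_apply (T : Tableau μ A) (a : A) :
    T.secondRow a = if T.row a = 1 then 1 else 0 := rfl

theorem secondRow_le_one (T : Tableau μ A) (a : A) : T.secondRow a ≤ 1 := by
  rw [secondRow_apply]; split_ifs <;> omega

theorem secondRow_eq_sum (T : Tableau μ A) :
    T.secondRow = ∑ j, Finsupp.single (T (μ.lowerBox j)) 1 := by
  ext a
  classical
  rw [secondRow_apply, Finsupp.finsetSum_apply]
  simp only [Finsupp.single_apply]
  split_ifs with h
  · obtain ⟨j, hj⟩ := YoungDiagram.eq_lowerBox_of_fst_eq_one _ h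
    rw [Finset.sum_eq_single j]
    · rw [if_pos (by rw [← hj, Equiv.apply_symm_apply])]
    · intro i _ hij
      refine if_neg fun hi => hij (Fin.ext ?_)
      rw [← Equiv.eq_symm_apply, hj] at hi
      exact congrArg (fun c => c.1.2) hi
    · simp
  · refine (sum_eq_zero fun j _ => if_neg ?_).symm
    rintro rfl
    exact h (by simp [row, YoungDiagram.lowerBox])

theorem degree_secondRow (T : Tableau μ A) : T.secondRow.degree = μ.rowLen 1 := by
  simp [secondRow_eq_sum]

/-- With only two rows, preserving the second row as a set preserves both. -/
theorem forall_row_eq_iff (h2 : μ.rowLen 2 = 0) (T : Tableau μ A) (σ : Equiv.Perm A) :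
    (∀ a, T.row (σ a) = T.row a) ↔ T.secondRow.mapDomain σ = T.secondRow := by
  rw [DFunLike.ext_iff,
    ← σ.forall_congr_right (q := fun a => T.secondRow.mapDomain σ a = T.secondRow a)]
  refine forall_congr' fun a => ?_
  rw [Finsupp.mapDomain_apply σ.injective, secondRow_apply, secondRow_apply]
  have h1 := YoungDiagram.fst_lt_two_of_rowLen_two h2 (T.symm a)
  have h3 := YoungDiagram.fst_lt_two_of_rowLen_two h2 (T.symm (σ a))
  unfold row
  split_ifs <;> simp <;> omega

theorem forall_col_eq_iff [DecidableEq A] (h2 : μ.rowLen 2 = 0) (T : Tableau μ A) (τ : Equiv.Perm A) :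
    (∀ a, T.col (τ a) = T.col a) ↔
      τ ∈ pairStabilizer (fun j => T (μ.upperBox j)) (fun j => T (μ.lowerBox j)) univ := by
  simp only [pairStabilizer, mem_filter, mem_univ, true_and]
  refine forall_congr' fun a => ?_
  constructor
  · intro h
    by_cases hr : T.row (τ a) = T.row a
    · exact .inl (T.symm.injective (Subtype.ext (Prod.ext hr h)))
    have h1 := YoungDiagram.fst_lt_two_of_rowLen_two h2 (T.symm a)
    have h3 := YoungDiagram.fst_lt_two_of_rowLen_two h2 (T.symm (τ a))
    right
    have hup : ∀ (b : A) (j : Fin (μ.rowLen 1)), T.row b = 0 → T.col b = (j : ℕ) → b = T (μ.upperBox j) := fun b j hb hj => by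
      rw [← Equiv.symm_apply_eq]
      exact Subtype.ext (Prod.ext hb hj)
    unfold row at hr
    rcases Nat.lt_succ_iff_lt_or_eq.1 h1 with h4 | h4
    · obtain ⟨j, hj⟩ := YoungDiagram.eq_lowerBox_of_fst_eq_one (T.symm (τ a)) (by omega)
      refine ⟨j, .inl (hup a j (by unfold row; omega) ?_), .inr ((Equiv.symm_apply_eq _).1 hj)⟩
      rw [← h, col, hj, YoungDiagram.lowerBox]
    · obtain ⟨j, hj⟩ := YoungDiagram.eq_lowerBox_of_fst_eq_one (T.symm a) h4
      refine ⟨j, .inr ((Equiv.symm_apply_eq _).1 hj), .inl (hup _ j (by unfold row; omega) ?_)⟩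
      rw [h, col, hj, YoungDiagram.lowerBox]
  · have hu : ∀ j, T.col (T (μ.upperBox j)) = j := fun j => by
      simp [col, YoungDiagram.upperBox]
    have hl : ∀ j, T.col (T (μ.lowerBox j)) = j := fun j => by
      simp [col, YoungDiagram.lowerBox]
    have hc : ∀ b j, b = T (μ.upperBox j) ∨ b = T (μ.lowerBox j) → T.col b = j := by
      rintro b j (rfl | rfl)
      · exact hu j
      · exact hl j
    rintro (h | ⟨j, h3, h4⟩)
    · rw [h]
    · rw [hc _ _ h3, hc _ _ h4]

end Tableau

/-- The elements of a tabloid of two-rowed shape are polarizations. -/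
theorem DTableau.elt_eq_polar (K : Type w) [Field K] {d n : ℕ} {μ : YoungDiagram}
    (h2 : μ.rowLen 2 = 0) (F : DTableau d n μ) {A : Type u} [Fintype A] [DecidableEq A]
    (T : Tableau μ A) : F.elt K T = GenSym.polar T.secondRow (Finsupp.single (F.partition T) 1)
      (pairProd K T.columnPairs) := by
  set z : GenSym K d A := Finsupp.single (F.partition T) 1
  -- The inverses appear because moving `τ` from `z` to the polynomial inverts it; the column group
  -- and the sign are unchanged by inversion.
  have h1 : pairProd K T.columnPairs = ∑ τ : Equiv.Perm A with ∀ a, T.col (τ a) = T.col a,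
      ((Equiv.Perm.sign τ : ℤ) : K) • rename τ.symm (monomial T.secondRow 1) := by
    have := sum_sign_smul_rename_prod K T.elim_injective univ 1 (by simp)
    rw [mul_one, mul_one] at this
    rw [pairProd, Tableau.columnPairs, Multiset.map_map]
    refine this.symm.trans (sum_equiv (Equiv.inv _) (fun τ => ?_) fun τ _ => ?_)
    · rw [← T.forall_col_eq_iff h2, mem_filter, Equiv.inv_apply,
        ← τ.forall_congr_right (q := fun a => T.col (τ⁻¹ a) = T.col a)]
      simp [eq_comm]
    · rw [T.secondRow_eq_sum, monomial_sum_one, Equiv.inv_apply, Equiv.Perm.sign_inv]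
      rfl
  rw [h1, map_sum, DTableau.elt, Tableau.symmetrizer, map_mul, Module.End.mul_apply]
  generalize hR : (GenSym.rep K d A).asAlgebraHom
    (∑ σ : Equiv.Perm A with ∀ a, T.row (σ a) = T.row a, MonoidAlgebra.of K (Equiv.Perm A) σ) = R
  rw [map_sum, LinearMap.sum_apply, map_sum]
  refine sum_congr rfl fun τ _ => ?_
  rw [map_smul, map_smul, LinearMap.smul_apply, map_smul]
  congr 1
  have h3 : z = GenSym.map K d τ.symm (GenSym.map K d τ z) := by
    rw [← GenSym.map_trans, Equiv.self_trans_symm]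
    exact (congrArg (· z) (Finsupp.lmapDomain_id K K)).symm
  conv_rhs => rw [h3, GenSym.polar_rename]
  rw [Representation.asAlgebraHom_of, ← hR, map_sum, LinearMap.sum_apply, GenSym.polar_apply, sum_filter]
  refine sum_congr rfl fun σ _ => ?_
  rw [rename_monomial, coeff_monomial, ite_smul, one_smul, zero_smul]
  refine if_congr (T.forall_row_eq_iff h2 σ) ?_ rfl
  rw [Representation.asAlgebraHom_of]
  rfl

/-! ### Tableaux with prescribed columns -/

/-- A bijection over a base, between families with equipotent finite fibers, can be prescribed on
part of its domain. -/
theorem exists_equiv_extend_of_card_fiber_eq {α β γ ι : Type*} [Finite α] [Finite β] {f : α → γ}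
    {g : β → γ} (hfg : ∀ c, Nat.card {a // f a = c} = Nat.card {b // g b = c}) {i : ι → α}
    {j : ι → β} (hi : Function.Injective i) (hj : Function.Injective j)
    (hij : ∀ x, g (j x) = f (i x)) :
    ∃ e : α ≃ β, (∀ a, g (e a) = f a) ∧ ∀ x, e (i x) = j x := by
  classical
  have := Fintype.ofFinite α
  have := Fintype.ofFinite β
  have e₀ : ∀ c, {a // f a = c} ≃ {b // g b = c} := fun c => (Finite.card_eq.1 (hfg c)).some
  have key : ∀ c, ∃ e : {a // f a = c} ≃ {b // b ∈ ({b | g b = c} : Finset β)},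
      ∀ a ∈ {a : {a // f a = c} | a.1 ∈ Set.range i},
        (e a : β) = Function.extend i j (Equiv.ofFiberEquiv e₀) a := by
    intro c
    refine Set.MapsTo.exists_equiv_extend_of_card_eq ?_ ?_ ?_
    · rw [← Fintype.card_subtype, ← Nat.card_eq_fintype_card, ← Nat.card_eq_fintype_card, hfg]
    · rintro ⟨_, rfl⟩ ⟨x, rfl⟩
      simp [hi.extend_apply, hij]
    · rintro ⟨_, h⟩ ⟨x, rfl⟩ ⟨_, h'⟩ ⟨y, rfl⟩ hxy
      simp only [hi.extend_apply] at hxy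
      simp [hj hxy]
  choose e he using key
  refine ⟨Equiv.ofFiberEquiv fun c => (e c).trans (Equiv.subtypeEquivRight (by simp)),
    fun a => Equiv.ofFiberEquiv_map _ a, fun x => ?_⟩
  exact (he (f (i x)) ⟨i x, rfl⟩ ⟨x, rfl⟩).trans (hi.extend_apply _ _ _)

theorem Multiset.exists_map_eq_of_rel {α β : Type*} {r : α → β → Prop} {s : Multiset α}
    {t : Multiset β} (hst : Multiset.Rel r s t) (hs : s.Nodup) [Nonempty (α → β)] :
    ∃ h : α → β, s.map h = t ∧ ∀ a ∈ s, r a (h a) := by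
  classical
  induction hst with
  | zero => exact ⟨Classical.arbitrary _, by simp⟩
  | @cons a b s t hab _ ih =>
    rw [Multiset.nodup_cons] at hs
    obtain ⟨h, h1, h2⟩ := ih hs.2
    have hne : ∀ x ∈ s, x ≠ a := fun x hx hxa => hs.1 (hxa ▸ hx)
    refine ⟨Function.update h a b, ?_, ?_⟩
    · rw [Multiset.map_cons, Function.update_self, ← h1]
      congr 1
      exact Multiset.map_congr rfl fun x hx => Function.update_of_ne (hne x hx) _ _
    · intro x hx
      rcases Multiset.mem_cons.1 hx with rfl | hx
      · rwa [Function.update_self]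
      · rw [Function.update_of_ne (hne x hx)]
        exact h2 x hx

theorem Multiset.exists_le_map_eq_of_le_map {α β : Type*} {f : α → β} {s : Multiset α}
    {t : Multiset β} (h : t ≤ s.map f) : ∃ s' ≤ s, s'.map f = t := by
  induction s using Quotient.inductionOn with
  | _ l =>
    induction t using Quotient.inductionOn with
    | _ l' =>
      obtain ⟨l₁, h1, h2⟩ : l'.Subperm (l.map f) := h
      obtain ⟨l₂, h3, rfl⟩ := List.sublist_map_iff.1 h2
      exact ⟨l₂, h3.subperm, Quotient.sound h1⟩

theorem Finset.prod_eq_or_eq_neg {ι R : Type*} [CommRing R] (s : Finset ι) {f g : ι → R}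
    (h : ∀ i, f i = g i ∨ f i = -g i) :
    ∏ i ∈ s, f i = ∏ i ∈ s, g i ∨ ∏ i ∈ s, f i = -∏ i ∈ s, g i := by
  classical
  induction s using Finset.induction_on with
  | empty => simp
  | insert i s hi ih =>
    rw [prod_insert hi, prod_insert hi]
    rcases h i with h1 | h1 <;> rcases ih with h2 | h2 <;> simp [h1, h2]

theorem nodup_pairPoints_map_univ {A ι : Type*} [Fintype ι] (h : ι → A × A) :
    (pairPoints (univ.val.map h)).Nodup ↔
      Function.Injective (Sum.elim (fun i => (h i).1) fun i => (h i).2) := by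
  have : pairPoints (univ.val.map h) =
      (univ : Finset (ι ⊕ ι)).val.map (Sum.elim (fun i => (h i).1) fun i => (h i).2) := by
    rw [pairPoints, Multiset.map_map, Multiset.map_map, ← univ_disjSum_univ, val_disjSum,
      Multiset.disjSum, Multiset.map_add, Multiset.map_map, Multiset.map_map]
    rfl
  rw [this, Multiset.nodup_map_iff_inj_on univ.nodup]
  simp only [mem_val, mem_univ, true_imp_iff]
  rfl

/-- A tableau on `A` with prescribed columns (up to the order of their entries) that is compatible
with a given filling. -/
theorem DTableau.exists_tableau (K : Type w) [Field K] {d n : ℕ} {μ : YoungDiagram}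
    (F : DTableau d n μ) {A : Type u} [Finite A] {v : A → Fin n}
    (hv : ∀ i, Nat.card {a // v a = i} = d) {L : Multiset (A × A)} (hL : (pairPoints L).Nodup)
    (hE : univ.val.map (fun j => s(F.entry (μ.upperBox j), F.entry (μ.lowerBox j))) =
      L.map fun x => s(v x.1, v x.2)) :
    ∃ T : Tableau μ A, (∀ c, v (T c) = F.entry c) ∧
      (pairProd K T.columnPairs = pairProd K L ∨ pairProd K T.columnPairs = -pairProd K L) := by
  have hcard : ∀ i, Nat.card {c // F.entry c = i} = Nat.card {a // v a = i} := by
    intro i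
    rw [hv, Nat.card_eq_fintype_card, Fintype.card_subtype, F.card_entry]
  -- Supplies the default function for the matching below. If there is a column, its entry has a
  -- nonempty fiber in the filling, hence in `A`.
  have hne : Nonempty (Fin (μ.rowLen 1) → A × A) := by
    rcases isEmpty_or_nonempty (Fin (μ.rowLen 1)) with h | ⟨⟨j⟩⟩
    · exact ⟨fun j => h.elim j⟩
    · have : Nonempty {c // F.entry c = F.entry (μ.upperBox j)} := ⟨⟨_, rfl⟩⟩
      have h1 := Nat.card_pos (α := {c // F.entry c = F.entry (μ.upperBox j)})
      rw [hcard] at h1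
      obtain ⟨a, -⟩ := (Nat.card_pos_iff.1 h1).1
      exact ⟨fun _ => (a, a)⟩
  obtain ⟨h, rfl, hh⟩ := Multiset.exists_map_eq_of_rel
    (Multiset.rel_map.1 (Multiset.rel_eq.2 hE)) univ.nodup
  -- Edges are unordered, so a matched pair may need reversing to fit the filling; each reversal
  -- costs a sign.
  have hflip : ∀ j, ∃ y : A × A, (y = h j ∨ y = (h j).swap) ∧
      v y.1 = F.entry (μ.upperBox j) ∧ v y.2 = F.entry (μ.lowerBox j) := by
    intro j
    rcases Sym2.eq_iff.1 (hh j (mem_univ j)) with ⟨h1, h2⟩ | ⟨h1, h2⟩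
    · exact ⟨h j, .inl rfl, h1.symm, h2.symm⟩
    · exact ⟨(h j).swap, .inr rfl, h1.symm, h2.symm⟩
  choose y hy hy1 hy2 using hflip
  rw [nodup_pairPoints_map_univ, Sum.elim_injective] at hL
  obtain ⟨hL1, hL2, hL3⟩ := hL
  have hyinj : Function.Injective (Sum.elim (fun j => (y j).1) fun j => (y j).2) := by
    refine Sum.elim_injective.2 ⟨fun i j hij => ?_, fun i j hij => ?_, fun i j hij => ?_⟩ <;>
    rcases hy i with h1 | h1 <;> rcases hy j with h2 | h2 <;>
    simp only [h1, h2, Prod.fst_swap, Prod.snd_swap] at hij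
    · exact hL1 hij
    · exact absurd hij (hL3 _ _)
    · exact absurd hij.symm (hL3 _ _)
    · exact hL2 hij
    · exact hL2 hij
    · exact absurd hij.symm (hL3 _ _)
    · exact absurd hij (hL3 _ _)
    · exact hL1 hij
    · exact hL3 _ _ hij
    · obtain rfl := hL1 hij
      exact hL3 i i (by have := h1.symm.trans h2; exact congrArg Prod.fst this)
    · obtain rfl := hL2 hij
      exact hL3 i i (by have := h2.symm.trans h1; exact congrArg Prod.fst this)
    · exact hL3 _ _ hij.symm
  obtain ⟨T, hT1, hT2⟩ := exists_equiv_extend_of_card_fiber_eq hcard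
    μ.elim_upperBox_lowerBox_injective hyinj (by rintro (j | j) <;> simp [hy1, hy2])
  refine ⟨T, hT1, ?_⟩
  have h3 : ∀ j, (X (T (μ.lowerBox j)) - X (T (μ.upperBox j)) : MvPolynomial A K) =
      X (y j).2 - X (y j).1 := fun j => by
    rw [← show T (μ.upperBox j) = (y j).1 from hT2 (.inl j),
      ← show T (μ.lowerBox j) = (y j).2 from hT2 (.inr j)]
  rw [pairProd, pairProd, Tableau.columnPairs, Multiset.map_map, Multiset.map_map]
  refine Finset.prod_eq_or_eq_neg univ fun j => ?_
  simp only [Function.comp_apply, h3]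
  rcases hy j with h4 | h4 <;> simp [h4]

/-! ### From products of pairs to graph covariants -/

namespace GenSym

variable {K : Type w} [Field K] {d : ℕ} {A B : Type u}
variable [Fintype A]

/-- The swap of the two ends fixes `z` but negates the product, so the polarization equals its own
negative. -/
theorem polar_pairProd_eq_zero [DecidableEq A] [Fintype B] [DecidableEq B] [CharZero K] (m : B →₀ ℕ) {z : GenSym K d A}
    {L : Multiset (A × A)} (hL : (pairPoints L).Nodup) {x : A × A} (hx : x ∈ L)
    (hz : map K d (Equiv.swap x.1 x.2) z = z) : polar m z (pairProd K L) = 0 := by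
  have h1 : rename (Equiv.swap x.1 x.2) (pairProd K L) = -pairProd K L := by
    obtain ⟨L, rfl⟩ := Multiset.exists_cons_of_mem hx
    rw [pairPoints_cons, Multiset.nodup_cons, Multiset.nodup_cons] at hL
    rw [pairProd_cons, map_mul, map_sub, rename_X, rename_X, Equiv.swap_apply_left,
      Equiv.swap_apply_right, ← neg_sub, neg_mul]
    congr 2
    rw [pairProd, map_multiset_prod, Multiset.map_map]
    congr 1
    refine Multiset.map_congr rfl fun y hy => ?_
    have h1 : ∀ a ∈ pairPoints L, Equiv.swap x.1 x.2 a = a := fun a ha =>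
      Equiv.swap_apply_of_ne_of_ne (fun h => hL.1 (Multiset.mem_cons_of_mem (h ▸ ha)))
        fun h => hL.2.1 (h ▸ ha)
    simp [h1 _ (mem_pairPoints.2 ⟨y, hy, .inl rfl⟩), h1 _ (mem_pairPoints.2 ⟨y, hy, .inr rfl⟩)]
  have h2 := polar_rename (Equiv.swap x.1 x.2) m z (pairProd K L)
  rw [h1, hz, map_neg] at h2
  exact self_eq_neg.1 h2.symm

theorem exists_perm_mapDomain_eq {m m' : A →₀ ℕ} (hm : ∀ a, m a ≤ 1) (hm' : ∀ a, m' a ≤ 1)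
    (h : m.degree = m'.degree) : ∃ σ : Equiv.Perm A, m.mapDomain σ = m' := by
  classical
  have hc : ∀ m : A →₀ ℕ, (∀ a, m a ≤ 1) → m.degree = Fintype.card {a // m a = 1} := by
    intro m hm
    rw [Finsupp.degree_eq_sum, Fintype.card_subtype, card_filter]
    refine sum_congr rfl fun a _ => ?_
    have := hm a
    split_ifs <;> omega
  rw [hc m hm, hc m' hm'] at h
  obtain ⟨e⟩ := Fintype.card_eq.1 h
  refine ⟨e.extendSubtype, ?_⟩
  ext a
  obtain ⟨a, rfl⟩ := e.extendSubtype.surjective a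
  rw [Finsupp.mapDomain_apply (Equiv.injective _)]
  have h1 := hm a
  have h2 := hm' (e.extendSubtype a)
  by_cases ha : m a = 1
  · rw [ha, e.extendSubtype_mem a ha]
  · have := e.extendSubtype_not_mem a ha
    omega

end GenSym

namespace GraphTableau

variable {K : Type w} [Field K] {d : ℕ} {V : Type v} {A : Type u} [Fintype A] [DecidableEq A]

theorem polar_pairProd_mem {R : MGraph V} (G : GraphTableau d R) {I : GenIdeal.{u} K d}
    (hI : I.Contains (G.tableau.tabloid K)) {v : A → {x // x ∈ R.verts}}
    (hv : ∀ x, Nat.card {a // v a = x} = d) {P : DPartition d A} (hP : P.1 = Setoid.ker v)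
    {L : Multiset (A × A)} (hL : (pairPoints L).Nodup)
    (hE : L.map (fun x => s((v x.1 : V), (v x.2 : V))) = R.edges) {m : A →₀ ℕ}
    (hm : ∀ a, m a ≤ 1) (hc : m.degree = L.card) :
    GenSym.polar m (Finsupp.single P 1) (pairProd K L) ∈ I.carrier A := by
  have hv' : ∀ i, Nat.card {a // G.label (v a) = i} = d := fun i =>
    (Nat.card_congr (Equiv.subtypeEquivRight fun a => (Equiv.eq_symm_apply _).symm)).trans
      (hv (G.label.symm i))
  obtain ⟨T, hT, hpm⟩ := G.tableau.exists_tableau K (v := fun a => G.label (v a)) hv' hL (by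
    refine Multiset.map_injective (f := Sym2.map fun i => (G.label.symm i : V)) ?_ ?_
    · exact Sym2.map.injective (Subtype.val_injective.comp G.label.symm.injective)
    · rw [Multiset.map_map, Multiset.map_map]
      refine G.edges_eq.trans (hE.symm.trans ?_)
      simp [Function.comp_def])
  have hPT : G.tableau.partition T = P := by
    refine Subtype.ext (hP ▸ Setoid.ext fun a b => ?_)
    have h1 : ∀ a, G.tableau.entry (T.symm a) = G.label (v a) := fun a => by
      rw [← hT, Equiv.apply_symm_apply]
    change G.tableau.entry (T.symm a) = G.tableau.entry (T.symm b) ↔ v a = v b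
    rw [h1, h1, G.label.apply_eq_iff_eq]
  have hmem : GenSym.polar T.secondRow (Finsupp.single P 1) (pairProd K L) ∈ I.carrier A := by
    have := hI A (G.tableau.elt K T) ⟨_, _, T, rfl⟩
    rw [G.tableau.elt_eq_polar K G.rowLen_two, hPT] at this
    rcases hpm with h | h
    · rwa [h] at this
    · rw [h, map_neg] at this
      exact (Submodule.neg_mem_iff _).1 this
  -- Both exponents are indicators of sets of the same size, so a permutation of `A`, under which
  -- the ideal is stable, carries the second row to `m`.
  obtain ⟨σ, rfl⟩ := GenSym.exists_perm_mapDomain_eq T.secondRow_le_one hm (by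
    rw [hc, T.degree_secondRow, G.rowLen_one, ← hE, Multiset.card_map])
  rw [← GenSym.map_polar]
  exact I.map_mem _ _ _ _ hmem

end GraphTableau

/-- The multigraph formed by the images of disjoint pairs under a map to the vertices. -/
def MGraph.ofPairs {V : Type v} {A : Type u} (s : Finset V) (v : A → {x // x ∈ s})
    (L : Multiset (A × A)) (hL : ∀ x ∈ L, v x.1 ≠ v x.2) : MGraph V where
  verts := s
  edges := L.map fun x => s((v x.1 : V), (v x.2 : V))
  mem_verts := by
    simp only [Multiset.mem_map]
    rintro _ ⟨y, -, rfl⟩ x hx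
    rcases Sym2.mem_iff.1 hx with rfl | rfl <;> exact Subtype.prop _
  not_isDiag := by
    simp only [Multiset.mem_map]
    rintro _ ⟨y, hy, rfl⟩ h
    exact hL y hy (Subtype.ext (Sym2.mk_isDiag_iff.1 h))

/-- Edges at a vertex use distinct points of its fiber, which has `d` elements. -/
theorem MGraph.maxDegreeLE_ofPairs {V : Type v} {A : Type u} [Finite A] {d : ℕ} {s : Finset V}
    {v : A → {x // x ∈ s}} (hv : ∀ x, Nat.card {a // v a = x} = d) {L : Multiset (A × A)}
    (hL : ∀ x ∈ L, v x.1 ≠ v x.2) (hnd : (pairPoints L).Nodup) :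
    (MGraph.ofPairs s v L hL).MaxDegreeLE d := by
  classical
  have := Fintype.ofFinite A
  intro x hx
  have h1 : ∀ L : Multiset (A × A), L.countP (fun y => x ∈ s((v y.1 : V), (v y.2 : V))) ≤
      (pairPoints L).countP fun a => v a = ⟨x, hx⟩ := by
    intro L
    induction L using Multiset.induction_on with
    | empty => simp
    | cons y L ih =>
      rw [pairPoints_cons, Multiset.countP_cons, Multiset.countP_cons, Multiset.countP_cons]
      simp only [Sym2.mem_iff, Subtype.ext_iff, eq_comm (a := x)]
      simp only [Sym2.mem_iff, Subtype.ext_iff, eq_comm (a := x)] at ih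
      split_ifs <;> first | omega | tauto
  have h2 : (pairPoints L).countP (fun a => v a = ⟨x, hx⟩) ≤ d := by
    rw [← hv ⟨x, hx⟩, Nat.card_eq_fintype_card, Fintype.card_subtype,
      Multiset.countP_eq_card_filter]
    refine Multiset.card_le_card ((Multiset.le_iff_subset (hnd.filter _)).2 fun a ha => ?_)
    simpa using (Multiset.mem_filter.1 ha).2
  refine le_trans (le_of_eq ?_) ((h1 L).trans h2)
  unfold MGraph.degree MGraph.ofPairs
  rw [Multiset.countP_map, ← Multiset.countP_eq_card_filter]

theorem vars_pairProd_subset (K : Type w) [Field K] {A : Type u} (L : Multiset (A × A)) :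
    ∀ a ∈ (pairProd K L).vars, a ∈ pairPoints L := by
  classical
  induction L using Multiset.induction_on with
  | empty => simp [pairProd]
  | cons x L ih =>
    intro a ha
    rw [pairProd_cons] at ha
    rw [pairPoints_cons, Multiset.mem_cons, Multiset.mem_cons]
    rcases mem_union.1 (vars_mul _ _ ha) with h | h
    · rcases mem_union.1 (vars_sub_subset _ h) with h | h <;> rw [vars_X, mem_singleton] at h <;>
      simp [h]
    · exact .inr (.inr (ih a h))

theorem rename_pairProd (K : Type w) [Field K] {A B : Type u} (f : A → B)
    (L : Multiset (A × A)) :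
    rename f (pairProd K L) = pairProd K (L.map (Prod.map f f)) := by
  simp [pairProd, map_multiset_prod, Multiset.map_map]

/-! ### The ideal of the enlargements, and the theorem -/

namespace GenIdeal

variable {K : Type w} [Field K] {d : ℕ}

theorem contains_generatedBy (E : GenElements.{u} K d) : (generatedBy E).Contains E := by
  intro A _ x hx
  simp only [generatedBy, Submodule.mem_iInf]
  exact fun J hJ => hJ A x hx

theorem generatedBy_le {E : GenElements.{u} K d} {J : GenIdeal.{u} K d} (h : J.Contains E) :
    generatedBy E ≤ J :=
  fun _ _ => iInf₂_le J h

end GenIdeal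

/-- A product of differences over pairs, multiplied by a polynomial in the remaining variables, has
its polarizations in the ideal of all enlargements of the graph formed by the pairs. -/
theorem polar_pairProd_mul_mem_familyIdeal {K : Type w} [Field K] [CharZero K] {V : Type v} {d : ℕ}
    {Q Q' : MGraph V} (G : ∀ R : MGraph V, R.MaxDegreeLE d → GraphTableau d R) {A : Type u}
    [Fintype A] [DecidableEq A] {v : A → {x // x ∈ Q'.verts}}
    (hv : ∀ x, Nat.card {a // v a = x} = d) {P : DPartition d A} (hP : P.1 = Setoid.ker v)
    {J : Multiset (A × A)} (hJ : (pairPoints J).Nodup)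
    (hE : J.map (fun x => s((v x.1 : V), (v x.2 : V))) = Q'.edges) {s : A →₀ ℕ} (c : K)
    (hs : Disjoint (pairPoints J) (Finsupp.toMultiset s)) {m : A →₀ ℕ} (hm : ∀ a, m a ≤ 1)
    (he : m.degree ≤ Q.edges.card) :
    GenSym.polar m (Finsupp.single P 1) (pairProd K J * monomial s c) ∈
      (familyIdeal K G (enlargements Q' Q) : GenIdeal.{u} K d).carrier A := by
  have hmon : monomial s c = c • ((Finsupp.toMultiset s).map (X (R := K))).prod := by
    rw [Finsupp.toMultiset_map, Finsupp.prod_toMultiset, monomial_eq, smul_eq_C_mul,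
      Finsupp.prod_mapDomain_index (by simp) (by simp [pow_add])]
  rw [hmon, mul_smul_comm, map_smul]
  refine Submodule.smul_mem _ _ (GenSym.polar_pairProd_mul_mem _ _ Q.edges.card J ?_ _ J le_rfl hJ
    hs m hm he)
  intro L hJL hL hLe m hm hc
  by_cases hloop : ∀ x ∈ L, v x.1 ≠ v x.2
  · have hdeg := MGraph.maxDegreeLE_ofPairs hv hloop hL
    refine (G (MGraph.ofPairs _ v L hloop) hdeg).polar_pairProd_mem (fun B _ x hx => ?_) hv hP hL
      rfl hm hc
    refine GenIdeal.contains_generatedBy _ B x ⟨MGraph.ofPairs _ v L hloop, ⟨rfl, ?_, ?_⟩, hdeg, hx⟩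
    · rw [← hE]
      exact Multiset.map_le_map hJL
    · exact (Multiset.card_map _ _).trans_le hLe
  -- A pair inside one block would be a loop; swapping its ends preserves the partition, so the
  -- polarization vanishes.
  · push Not at hloop
    obtain ⟨x, hx, hxv⟩ := hloop
    rw [GenSym.polar_pairProd_eq_zero m hL hx]
    · exact Submodule.zero_mem _
    · rw [GenSym.map_single]
      congr 1
      refine Subtype.ext (Setoid.ext fun a b => ?_)
      have h1 : ∀ a, v (Equiv.swap x.1 x.2 a) = v a := by
        intro a
        rw [Equiv.swap_apply_def]
        split_ifs with h1 h2
        · rw [h1, hxv]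
        · rw [h2, hxv]
        · rfl
      change P.1 (Equiv.swap x.1 x.2 a) (Equiv.swap x.1 x.2 b) ↔ P.1 a b
      rw [hP, Setoid.ker_def, Setoid.ker_def, h1, h1]

/-- The partition of a union of fibers of size `d` into these fibers. -/
def DPartition.ofFibers {d : ℕ} {A : Type u} {X : Type*} (v : A → X)
    (hv : ∀ x, Nat.card {a // v a = x} = d) (p : X → Prop) : DPartition d {a // p (v a)} :=
  DPartition.mk' (Setoid.ker fun a => v a.1) fun a => by
    rw [← hv (v a.1), ← Nat.card_coe_set_eq]
    refine Nat.card_congr ⟨fun b => ⟨b.1.1, b.2⟩, fun b => ⟨⟨b.1, ?_⟩, b.2⟩, fun b => rfl,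
      fun b => rfl⟩
    rw [b.2]
    exact a.2

theorem mainTheorem6 {K : Type w} [Field K] [CharZero K] {V : Type v} (d : ℕ) (hd : 0 < d)
    (Q Q' : MGraph V) (hQ : Q'.IsSubgraph Q) (F : GraphTableau d Q)
    (G : ∀ R : MGraph V, R.MaxDegreeLE d → GraphTableau d R) :
    F.ideal K ≤ (familyIdeal K G (enlargements Q' Q) : GenIdeal.{u} K d) := by
  classical
  refine GenIdeal.generatedBy_le fun A _ x hx => ?_
  obtain ⟨_, _, T, rfl⟩ := hx
  rw [F.tableau.elt_eq_polar K F.rowLen_two]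
  set vtx : A → {x // x ∈ Q.verts} := fun a => F.label.symm (F.tableau.entry (T.symm a)) with hvtx
  have hcard : ∀ x, Nat.card {a // vtx a = x} = d := by
    intro x
    rw [← F.tableau.card_entry (F.label x), ← Fintype.card_subtype, ← Nat.card_eq_fintype_card]
    exact Nat.card_congr (T.symm.subtypeEquiv fun a => Equiv.symm_apply_eq _)
  have hedges : T.columnPairs.map (fun x => s((vtx x.1 : V), (vtx x.2 : V))) = Q.edges := by
    rw [← F.edges_eq, Tableau.columnPairs, Multiset.map_map]
    simp only [hvtx, Function.comp_def, Equiv.symm_apply_apply]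
    rfl
  -- `J` selects columns of `T` that realize the edges of `Q'` with their multiplicities.
  obtain ⟨J, hJ, hJE⟩ := Multiset.exists_le_map_eq_of_le_map (hQ.2.trans_eq hedges.symm)
  let p : {x // x ∈ Q.verts} → Prop := fun x => (x : V) ∈ Q'.verts
  have hJp : ∀ x ∈ J, p (vtx x.1) ∧ p (vtx x.2) := by
    intro x hx
    have := Q'.mem_verts _ (hJE ▸ Multiset.mem_map_of_mem _ hx)
    exact ⟨this _ (Sym2.mem_mk_left _ _), this _ (Sym2.mem_mk_right _ _)⟩
  let φ : {a // p (vtx a)} ⊕ {a // ¬ p (vtx a)} ≃ A := Equiv.sumCompl fun a => p (vtx a)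
  let P₁ := DPartition.ofFibers vtx hcard p
  let P₂ := DPartition.ofFibers vtx hcard fun x => ¬ p x
  have hP : F.tableau.partition T = (P₁.disjUnion P₂).map φ := by
    refine Subtype.ext (Setoid.ext fun a b => ?_)
    obtain ⟨a, rfl⟩ := φ.surjective a
    obtain ⟨b, rfl⟩ := φ.surjective b
    have h1 : (F.tableau.partition T).1 (φ a) (φ b) ↔ vtx (φ a) = vtx (φ b) :=
      F.label.symm.apply_eq_iff_eq.symm
    have h2 : ((P₁.disjUnion P₂).map φ).1 (φ a) (φ b) ↔ (P₁.disjUnion P₂).1 a b := by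
      change (P₁.disjUnion P₂).1 (φ.symm (φ a)) (φ.symm (φ b)) ↔ _
      rw [φ.symm_apply_apply, φ.symm_apply_apply]
    rw [h1, h2]
    rcases a with a | a <;> rcases b with b | b
    · exact (DPartition.disjUnion_inl_inl (P := P₁) (R := P₂)).symm
    · exact iff_of_false (fun h => b.2 (h ▸ a.2)) DPartition.not_disjUnion_inl_inr
    · exact iff_of_false (fun h => a.2 (h ▸ b.2)) DPartition.not_disjUnion_inr_inl
    · exact (DPartition.disjUnion_inr_inr (P := P₁) (R := P₂)).symm
  obtain ⟨J₁, hJ₁⟩ : ∃ J₁ : Multiset ({a // p (vtx a)} × {a // p (vtx a)}),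
      J₁.map (Prod.map Subtype.val Subtype.val) = J :=
    ⟨J.pmap (fun x h => (⟨x.1, h.1⟩, ⟨x.2, h.2⟩)) hJp,
      by
      rw [Multiset.map_pmap]
      exact (Multiset.pmap_eq_map _ id _ hJp).trans J.map_id⟩
  obtain ⟨L, hL⟩ := Multiset.le_iff_exists_add.1 hJ
  have hnd : (pairPoints J + pairPoints L).Nodup := by
    have := (nodup_pairPoints_map_univ
      fun j => (T (F.shape.upperBox j), T (F.shape.lowerBox j))).2 T.elim_injective
    rw [← Tableau.columnPairs, hL] at this
    convert this using 1
    simp only [pairPoints, Multiset.map_add]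
    abel
  rw [Multiset.nodup_add] at hnd
  obtain ⟨hndJ, -, hdisj⟩ := hnd
  have hpts : ∀ a ∈ pairPoints J₁, a.1 ∈ pairPoints J := by
    intro a ha
    obtain ⟨x, hx, h⟩ := mem_pairPoints.1 ha
    refine mem_pairPoints.2 ⟨_, hJ₁ ▸ Multiset.mem_map_of_mem _ hx, ?_⟩
    rcases h with rfl | rfl <;> simp
  have hpoly : pairProd K T.columnPairs =
      rename φ (rename Sum.inl (pairProd K J₁) * rename φ.symm (pairProd K L)) := by
    rw [map_mul, rename_rename, rename_rename, φ.self_comp_symm, rename_id_apply,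
      show φ ∘ Sum.inl = Subtype.val from rfl, rename_pairProd, hJ₁, hL, pairProd, pairProd,
      pairProd, Multiset.map_add, Multiset.prod_add]
  have hz : (Finsupp.single (F.tableau.partition T) 1 : GenSym K d A) =
      GenSym.map K d φ (GenSym.mul K d (Finsupp.single P₁ 1) (Finsupp.single P₂ 1)) := by
    rw [GenSym.mul_single, GenSym.map_single, hP, mul_one]
  -- Only the differences outside `J` are expanded. Each resulting monomial factors into a part on
  -- the blocks of `V(Q')` and a part on the other blocks.
  rw [hpoly, hz, GenSym.polar_rename, (rename φ.symm (pairProd K L)).as_sum, mul_sum, map_sum]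
  refine Submodule.sum_mem _ fun s hs => ?_
  set c := coeff s (rename φ.symm (pairProd K L))
  set s₁ := s.comapDomain Sum.inl Sum.inl_injective.injOn
  set s₂ := s.comapDomain Sum.inr Sum.inr_injective.injOn
  have hs₁₂ : s = s₁.mapDomain Sum.inl + s₂.mapDomain Sum.inr := by
    ext (a | a) <;> simp [s₁, s₂, Finsupp.mapDomain_apply Sum.inl_injective,
      Finsupp.mapDomain_apply Sum.inr_injective, Finsupp.mapDomain_of_notMem_range]
  have hmon : monomial s c = rename Sum.inl (monomial s₁ c) * rename Sum.inr (monomial s₂ 1) := by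
    rw [rename_monomial, rename_monomial, monomial_mul, mul_one, ← hs₁₂]
  rw [hmon, ← mul_assoc, ← map_mul]
  refine GenSym.polar_mul_mem _ T.secondRow_le_one _ _ _ _ fun m' hm' hdeg => ?_
  let v : {a // p (vtx a)} → {x // x ∈ Q'.verts} := fun a => ⟨vtx a.1, a.2⟩
  refine polar_pairProd_mul_mem_familyIdeal G (v := v) ?_ ?_ ?_ ?_ c ?_ hm' ?_
  · intro x
    rw [← hcard ⟨x, hQ.1 x.2⟩]
    refine Nat.card_congr ⟨fun a => ⟨a.1.1, ?_⟩, fun a => ⟨⟨a.1, ?_⟩, ?_⟩, fun a => rfl,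
      fun a => rfl⟩
    · exact Subtype.ext (congrArg (fun y : {x // x ∈ Q'.verts} => (y : V)) a.2)
    · change (vtx a.1 : V) ∈ Q'.verts
      rw [a.2]
      exact x.2
    · exact Subtype.ext (congrArg (fun y : {x // x ∈ Q.verts} => (y : V)) a.2)
  · refine Setoid.ext fun a b => ?_
    change vtx a = vtx b ↔ v a = v b
    rw [Subtype.ext_iff, Subtype.ext_iff]
  · rw [← hJ₁] at hndJ
    refine Multiset.Nodup.of_map Subtype.val ?_
    convert hndJ using 1
    simp [pairPoints, Multiset.map_map]
  · rw [← hJE, ← hJ₁, Multiset.map_map]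
    rfl
  -- Variables of the monomial come from columns outside `J`, whose points are disjoint from those
  -- of `J` because `T` is injective.
  · rw [Multiset.disjoint_left]
    intro a ha has
    refine Multiset.disjoint_left.1 hdisj (hpts a ha) (vars_pairProd_subset K L _ ?_)
    have h1 : Sum.inl a ∈ (rename φ.symm (pairProd K L)).vars := by
      rw [mem_vars_iff_mem_support]
      refine ⟨s, hs, ?_⟩
      simpa [s₁] using has
    obtain ⟨b, hb, hba⟩ := mem_vars_rename _ _ h1
    rwa [← show b = a.1 from (φ.symm_apply_eq.1 hba)]
  · rwa [T.degree_secondRow, F.rowLen_one] at hdeg
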